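/- Conventions. A size-$k$ partition of a set $S\subseteq\mathbb R$ means a partition of $S$ into $k$ nonempty intervals. A $k\times\ell$ grid $G=(P,Q)$ consists of a size-$k$ partition $P=\{P_1,\dots,P_k\}$ (rows, applied to the $y$-coordinate) and a size-$\ell$ partition $Q=\{Q_1,\dots,Q_\ell\}$ (columns, applied to the $x$-coordinate). For a probability distribution $\Pi$ of a pair $(X,Y)$ put $p(i,j)=\Pr(X\in Q_j,\,Y\in P_i)$; for a dataset $D$ of $n$ points in $\mathbb R^2$ put $p(i,j)=\frac1n\,\#\{(x,y)\in D: x\in Q_j,\ y\in P_i\}$ (counted with multiplicity). In either case let $$I=\sum_{i,j}p(i,j)\log_2\frac{p(i,j)}{p(i,*)\,p(*,j)},\qquad I^\star=\frac{I}{\log_2\min\{k,\ell\}},$$ where $p(i,*)$ and $p(*,j)$ are the row and column sums and $0\log 0=0$; write $I^\star(\Pi|_G)$ and $I^\star(D|_G)$ respectively. Define $$\mathrm{MIC}^*(\Pi)=\sup_{k,\ell\ge2}\ \sup_{G}\ I^\star(\Pi|_G),$$ where $G$ ranges over all $k\times\ell$ grids on $\mathbb R^2$ (both axes partitioned arbitrarily).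 Let $L=[x_0,x_1]\times[y_0,y_1]$ with $x_0<x_1$, $y_0<y_1$. The size-$\ell$ range equipartition of $[a,b]$ is its partition into the $\ell$ intervals $[a+j\frac{b-a}{\ell},\,a+(j+1)\frac{b-a}{\ell})$, $0\le j<\ell$, the last one closed. For $k,\ell\ge2$ let $\mathcal R(L,\infty,k,\ell)$ be the set of $k\times\ell$ grids $(P,Q)$ on $L$ such that: if $k\le\ell$, $Q$ is the size-$\ell$ range equipartition of $[x_0,x_1]$ and $P$ is an arbitrary size-$k$ partition of $[y_0,y_1]$; if $k>\ell$, $P$ is the size-$k$ range equipartition of $[y_0,y_1]$ and $Q$ is an arbitrary size-$\ell$ partition of $[x_0,x_1]$. For a dataset $D$ and a real number $B$ put $$\mathrm{MICr}(D,L,B,\infty)=\max_{k,\ell\ge2,\ k\ell\le B}\ \ \max_{G\in\mathcal R(L,\infty,k,\ell)} I^\star(D|_G).$$ Theorem. Let $\Pi=(X,Y)$ be a jointly distributed pair of real random variables that lies in $L$ almost surely, and for each $n$ let $D_n$ be a dataset of $n$ points sampled i.i.d. from $\Pi$. Let $0<\alpha<\tfrac12$ and let $B:\mathbb N\to\mathbb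 R$ satisfy $B(n)\to\infty$ and $B(n)=O(n^\alpha)$ as $n\to\infty$. Then $$\mathrm{MICr}(D_n,L,B(n),\infty)\longrightarrow\mathrm{MIC}^*(\Pi)\quad\text{in probability as } n\to\infty .$$ -/

import Mathlib

open Filter Topology MeasureTheory ProbabilityTheory
open scoped Asymptotics

namespace MICr

noncomputable section

/-- A range `L = [x₀, x₁] × [y₀, y₁]` in the plane. -/
structure PlaneRange where
  x₀ : ℝ
  x₁ : ℝ
  y₀ : ℝ
  y₁ : ℝ
  hx : x₀ < x₁
  hy : y₀ < y₁

/-- The set of points of the plane that lie in the range `L`. -/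
def PlaneRange.toSet (L : PlaneRange) : Set (ℝ × ℝ) :=
  Set.Icc L.x₀ L.x₁ ×ˢ Set.Icc L.y₀ L.y₁

/-- `P 0, …, P (k-1)` is a size-`k` partition of `S ⊆ ℝ` into nonempty intervals (open, closed or
half-open, bounded or not). The order in which the parts are listed plays no role below. -/
structure IsIntervalPartition (S : Set ℝ) {k : ℕ} (P : Fin k → Set ℝ) : Prop where
  nonempty : ∀ i, (P i).Nonempty
  interval : ∀ i, (P i).OrdConnected
  disjoint : Pairwise fun i j => Disjoint (P i) (P j)
  cover : ⋃ i, P i = S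

/-- The size-`ℓ` range equipartition of `[a, b]`: the part with index `j` is
`[a + j (b - a) / ℓ, a + (j + 1) (b - a) / ℓ)`, and the last part also contains `b`. -/
def rangeEquipartition (a b : ℝ) (ℓ : ℕ) (j : Fin ℓ) : Set ℝ :=
  {t | a + (j : ℝ) * ((b - a) / ℓ) ≤ t ∧
    (t < a + ((j : ℝ) + 1) * ((b - a) / ℓ) ∨ ((j : ℕ) + 1 = ℓ ∧ t = b))}

/-- A `k × ℓ` grid `G = (P, Q)`: the `k` parts `P i` partition the `y`-axis (rows), the `ℓ` parts
`Q j` partition the `x`-axis (columns). -/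
abbrev Grid (k ℓ : ℕ) : Type := (Fin k → Set ℝ) × (Fin ℓ → Set ℝ)

/-- The cell of the grid in row `i` and column `j`, as a set of points `(x, y)`. -/
def cell {k ℓ : ℕ} (G : Grid k ℓ) (i : Fin k) (j : Fin ℓ) : Set (ℝ × ℝ) :=
  G.2 j ×ˢ G.1 i

/-- The set of all `k × ℓ` grids on the plane. -/
def allGrids (k ℓ : ℕ) : Set (Grid k ℓ) :=
  {G | IsIntervalPartition Set.univ G.1 ∧ IsIntervalPartition Set.univ G.2}

/-- The set `R(L, ∞, k, ℓ)` of grids on `L`: if `k ≤ ℓ`, the columns are the range equipartition of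
`[x₀, x₁]` and the rows are an arbitrary partition of `[y₀, y₁]`; if `k > ℓ`, the rows are the range
equipartition of `[y₀, y₁]` and the columns are an arbitrary partition of `[x₀, x₁]`. -/
def rangeGrids (L : PlaneRange) (k ℓ : ℕ) : Set (Grid k ℓ) :=
  {G | (k ≤ ℓ ∧ G.2 = rangeEquipartition L.x₀ L.x₁ ℓ ∧
          IsIntervalPartition (Set.Icc L.y₀ L.y₁) G.1) ∨
       (ℓ < k ∧ G.1 = rangeEquipartition L.y₀ L.y₁ k ∧
          IsIntervalPartition (Set.Icc L.x₀ L.x₁) G.2)}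

/-- Discrete mutual information, in bits, of the joint mass function `p` on `[k] × [ℓ]`. With the
conventions of `Real.logb` and division, terms with `p i j = 0` contribute `0`. -/
def mutualInfo {k ℓ : ℕ} (p : Fin k → Fin ℓ → ℝ) : ℝ :=
  ∑ i, ∑ j, p i j * Real.logb 2 (p i j / ((∑ j', p i j') * ∑ i', p i' j))

/-- Normalized mutual information `I / log₂ (min k ℓ)`. -/
def normMutualInfo {k ℓ : ℕ} (p : Fin k → Fin ℓ → ℝ) : ℝ :=
  mutualInfo p / Real.logb 2 (min k ℓ : ℕ)

open Classical in
/-- The normalized count matrix of a dataset `D` of `n` points and a grid. -/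
def sampleMatrix {n : ℕ} (D : Fin n → ℝ × ℝ) {k ℓ : ℕ} (G : Grid k ℓ) (i : Fin k) (j : Fin ℓ) : ℝ :=
  (1 / (n : ℝ)) * ((Finset.univ.filter fun m : Fin n => D m ∈ cell G i j).card : ℝ)

/-- The matrix of cell probabilities of a distribution `μ` on the plane and a grid. -/
def distMatrix (μ : Measure (ℝ × ℝ)) {k ℓ : ℕ} (G : Grid k ℓ) (i : Fin k) (j : Fin ℓ) : ℝ :=
  μ.real (cell G i j)

/-- The `(k, ℓ)` entry of the unconstrained range-equicharacteristic matrix of a dataset. The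
supremum is a maximum, since for a given dataset only finitely many values occur. -/
def rangeEntry {n : ℕ} (D : Fin n → ℝ × ℝ) (L : PlaneRange) (k ℓ : ℕ) : ℝ :=
  sSup ((fun G : Grid k ℓ => normMutualInfo (sampleMatrix D G)) '' rangeGrids L k ℓ)

/-- The unconstrained statistic `MICr(D, L, B, ∞)`, the maximum of the entries with `k, ℓ ≥ 2` and
`k ℓ ≤ B`. -/
def micrUnconstrained {n : ℕ} (D : Fin n → ℝ × ℝ) (L : PlaneRange) (B : ℝ) : ℝ :=
  sSup {m | ∃ k ℓ : ℕ, 2 ≤ k ∧ 2 ≤ ℓ ∧ ((k * ℓ : ℕ) : ℝ) ≤ B ∧ m = rangeEntry D L k ℓ}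

/-- The `(k, ℓ)` entry of the characteristic matrix of a distribution. -/
def charEntry (μ : Measure (ℝ × ℝ)) (k ℓ : ℕ) : ℝ :=
  sSup ((fun G : Grid k ℓ => normMutualInfo (distMatrix μ G)) '' allGrids k ℓ)

/-- `MIC*` of a distribution: the supremum of its characteristic matrix. -/
def micStar (μ : Measure (ℝ × ℝ)) : ℝ :=
  sSup {m | ∃ k ℓ : ℕ, 2 ≤ k ∧ 2 ≤ ℓ ∧ m = charEntry μ k ℓ}

end

end MICr

/-! Deviation. In a grid of `rangeGrids` one axis is a range equipartition, so every cell is one of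
polynomially many fixed strips cut by an arbitrary interval. Hoeffding's inequality on finitely many
bracketing sets, with a union bound, gives outside probability `8 (n+1)^3 exp (-2 n δ^2)` that all
cells and marginals with `k, ℓ ≤ n` have empirical and true mass within `2 (δ + 1/n)`
(`measure_exists_interval_deviation_le`). Mutual information is a combination of entropies and `-x
log x` is Hölder of every exponent `1 - γ < 1`, so `I⋆` moves by at most a constant times `k ℓ (δ +
1/n)^(1-γ)`. With `k ℓ ≤ B n = O(n^α)` and `δ = n^(-β)`, both bounds vanish once `α < β (1 - γ)` and
`β < 1/2`; this is where `α < 1/2` enters.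

Value of the limit. A grid on `L` extends to the plane without changing cell masses, so the
population value of a range grid is at most `micStar`. Conversely, take a nearly optimal grid with,
by symmetry, `k ≤ ℓ`. The normalizer depends only on `k`, so the columns may be refined freely:
merging cells of a fine range equipartition approximates the given columns, and merging never
increases mutual information (`mutualInfo_merge_le`). Hence one fixed range grid is nearly optimal
(`exists_rangeGrid_approx`), and it is admissible once `B n` is large. -/

namespace MICr

open Real

/-! ### Mutual information of finite matrices of mass at most one. -/

section Discrete

variable {k ℓ : ℕ} {p q : Fin k → Fin ℓ → ℝ}

/-- Row entropy plus column entropy minus joint entropy; no normalization of `p` is needed.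
Continuity questions reduce to the scalar function `negMulLog`. -/
theorem mutualInfo_eq_negMulLog (hp : ∀ i j, 0 ≤ p i j) :
    mutualInfo p = (∑ i, negMulLog (∑ j, p i j) + ∑ j, negMulLog (∑ i, p i j)
      - ∑ i, ∑ j, negMulLog (p i j)) / log 2 := by
  have hterm : ∀ i j, p i j * logb 2 (p i j / ((∑ j', p i j') * ∑ i', p i' j)) =
      (p i j * -log (∑ j', p i j') + p i j * -log (∑ i', p i' j) - negMulLog (p i j))
        / log 2 := by
    intro i j
    rcases (hp i j).eq_or_lt with h | h
    · simp [← h]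
    · have hr : 0 < ∑ j', p i j' :=
        h.trans_le (Finset.single_le_sum (fun j _ => hp i j) (Finset.mem_univ j))
      have hc : 0 < ∑ i', p i' j :=
        h.trans_le (Finset.single_le_sum (f := fun i => p i j) (fun i _ => hp i j)
          (Finset.mem_univ i))
      rw [logb, log_div h.ne' (mul_pos hr hc).ne', log_mul hr.ne' hc.ne', negMulLog]
      ring
  have h1 : ∑ i, negMulLog (∑ j, p i j) = ∑ i, ∑ j, p i j * -log (∑ j', p i j') := by
    refine Finset.sum_congr rfl fun i _ => ?_
    rw [← Finset.sum_mul, negMulLog]; ring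
  have h2 : ∑ j, negMulLog (∑ i, p i j) = ∑ i, ∑ j, p i j * -log (∑ i', p i' j) := by
    rw [Finset.sum_comm]
    refine Finset.sum_congr rfl fun j _ => ?_
    rw [← Finset.sum_mul, negMulLog]; ring
  simp only [mutualInfo, hterm, h1, h2]
  simp only [← Finset.sum_div, Finset.sum_add_distrib, Finset.sum_sub_distrib]

theorem negMulLog_add_le {a d : ℝ} (ha : 0 ≤ a) (hd : 0 ≤ d) :
    negMulLog (a + d) ≤ negMulLog a + negMulLog d := by
  rcases ha.eq_or_lt with rfl | ha
  · simp
  rcases hd.eq_or_lt with rfl | hd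
  · simp
  have h1 : log a ≤ log (a + d) := log_le_log ha (by linarith)
  have h2 : log d ≤ log (a + d) := log_le_log hd (by linarith)
  simp only [negMulLog]
  nlinarith

theorem negMulLog_sub_add_le {a d : ℝ} (ha : 0 ≤ a) (hd : 0 ≤ d) (h : a + d ≤ 1) :
    negMulLog a - negMulLog (a + d) ≤ d := by
  rcases ha.eq_or_lt with rfl | ha
  · have : 0 ≤ negMulLog d := negMulLog_nonneg hd (by linarith)
    simp only [negMulLog_zero, zero_add, zero_sub]
    linarith
  have h1 : log (a + d) ≤ 0 := log_nonpos (by linarith) h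
  have h2 : log ((a + d) / a) ≤ (a + d) / a - 1 := log_le_sub_one_of_pos (by positivity)
  rw [log_div (by positivity) ha.ne'] at h2
  have h3 : a * (log (a + d) - log a) ≤ d := by
    calc _ ≤ a * ((a + d) / a - 1) := by gcongr
      _ = d := by field_simp; ring
  simp only [negMulLog]
  nlinarith

theorem negMulLog_le_rpow_div {d γ : ℝ} (hd : 0 ≤ d) (hγ : 0 < γ) (hγ1 : γ < 1) :
    negMulLog d ≤ d ^ (1 - γ) / γ := by
  rcases hd.eq_or_lt with rfl | hd
  · simp [zero_rpow (by linarith : (1 - γ) ≠ 0)]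
  have h := log_le_rpow_div (inv_nonneg.2 hd.le) hγ
  rw [log_inv, inv_rpow hd.le] at h
  calc negMulLog d = d * (-log d) := by rw [negMulLog]; ring
    _ ≤ d * ((d ^ γ)⁻¹ / γ) := by gcongr
    _ = d ^ (1 - γ) / γ := by rw [rpow_sub hd, rpow_one]; ring

/-- Over a step `d`, subadditivity limits the increase to `negMulLog d`, hence to `d ^ (1 - γ) / γ`;
the decrease is at most `d`, which is smaller still on `[0, 1]`. -/
theorem abs_negMulLog_sub_le {a b δ γ : ℝ} (ha : 0 ≤ a) (ha1 : a ≤ 1) (hb : 0 ≤ b) (hb1 : b ≤ 1)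
    (hγ : 0 < γ) (hγ1 : γ < 1) (hab : |a - b| ≤ δ) :
    |negMulLog a - negMulLog b| ≤ δ ^ (1 - γ) / γ := by
  wlog hle : a ≤ b generalizing a b
  · rw [abs_sub_comm]
    exact this hb hb1 ha ha1 (by rwa [abs_sub_comm]) (le_of_not_ge hle)
  obtain ⟨d, rfl⟩ := exists_add_of_le hle
  have hd : 0 ≤ d := by linarith
  have hd1 : d ≤ 1 := by linarith
  have hdδ : d ≤ δ := by
    rw [abs_sub_comm] at hab
    simpa [abs_of_nonneg hd] using hab
  have hmono : d ^ (1 - γ) / γ ≤ δ ^ (1 - γ) / γ := by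
    gcongr
  refine le_trans ?_ hmono
  rw [abs_le]
  constructor
  · linarith [negMulLog_add_le ha hd, negMulLog_le_rpow_div hd hγ hγ1]
  · refine (negMulLog_sub_add_le ha hd hb1).trans ?_
    rw [le_div_iff₀ hγ]
    have h1 : d ≤ d ^ (1 - γ) := by
      simpa using rpow_le_rpow_of_exponent_ge' hd hd1 (by linarith : 0 ≤ 1 - γ)
        (by linarith : 1 - γ ≤ 1)
    nlinarith

/-- The three entropies have `k`, `ℓ` and `k * ℓ` terms, each count at most `k * ℓ`. Closeness of
the marginals is a separate hypothesis, since summing cell errors would lose a factor `k` or `ℓ`. -/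
theorem abs_mutualInfo_sub_le {δ γ : ℝ} (hγ : 0 < γ) (hγ1 : γ < 1) (hk : 1 ≤ k) (hℓ : 1 ≤ ℓ)
    (hδ : 0 ≤ δ) (hp : ∀ i j, 0 ≤ p i j) (hq : ∀ i j, 0 ≤ q i j)
    (hp1 : ∑ i, ∑ j, p i j ≤ 1) (hq1 : ∑ i, ∑ j, q i j ≤ 1)
    (hpq : ∀ i j, |p i j - q i j| ≤ δ)
    (hr : ∀ i, |∑ j, p i j - ∑ j, q i j| ≤ δ)
    (hc : ∀ j, |∑ i, p i j - ∑ i, q i j| ≤ δ) :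
    |mutualInfo p - mutualInfo q| ≤ 3 * (k * ℓ) * (δ ^ (1 - γ) / γ) / log 2 := by
  have key : ∀ p : Fin k → Fin ℓ → ℝ, (∀ i j, 0 ≤ p i j) → ∑ i, ∑ j, p i j ≤ 1 →
      (∀ i, ∑ j, p i j ≤ 1) ∧ (∀ j, ∑ i, p i j ≤ 1) ∧ (∀ i j, p i j ≤ 1) := by
    intro p hp hp1
    have h1 : ∀ i, ∑ j, p i j ≤ 1 := fun i =>
      (Finset.single_le_sum (f := fun i => ∑ j, p i j)
        (fun i _ => Finset.sum_nonneg fun j _ => hp i j) (Finset.mem_univ i)).trans hp1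
    have h2 : ∀ j, ∑ i, p i j ≤ 1 := fun j => by
      rw [Finset.sum_comm] at hp1
      exact (Finset.single_le_sum (f := fun j => ∑ i, p i j)
        (fun j _ => Finset.sum_nonneg fun i _ => hp i j) (Finset.mem_univ j)).trans hp1
    exact ⟨h1, h2, fun i j =>
      (Finset.single_le_sum (fun j _ => hp i j) (Finset.mem_univ j)).trans (h1 i)⟩
  obtain ⟨pr, pc, pe⟩ := key p hp hp1
  obtain ⟨qr, qc, qe⟩ := key q hq hq1
  set e := δ ^ (1 - γ) / γ with he
  have he0 : 0 ≤ e := by positivity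
  have b1 : |∑ i, negMulLog (∑ j, p i j) - ∑ i, negMulLog (∑ j, q i j)| ≤ k * e := by
    rw [← Finset.sum_sub_distrib]
    refine (Finset.abs_sum_le_sum_abs _ _).trans ?_
    refine (Finset.sum_le_sum fun i _ => abs_negMulLog_sub_le
      (Finset.sum_nonneg fun j _ => hp i j) (pr i) (Finset.sum_nonneg fun j _ => hq i j) (qr i)
      hγ hγ1 (hr i)).trans ?_
    simp [he]
  have b2 : |∑ j, negMulLog (∑ i, p i j) - ∑ j, negMulLog (∑ i, q i j)| ≤ ℓ * e := by
    rw [← Finset.sum_sub_distrib]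
    refine (Finset.abs_sum_le_sum_abs _ _).trans ?_
    refine (Finset.sum_le_sum fun j _ => abs_negMulLog_sub_le
      (Finset.sum_nonneg fun i _ => hp i j) (pc j) (Finset.sum_nonneg fun i _ => hq i j) (qc j)
      hγ hγ1 (hc j)).trans ?_
    simp [he]
  have b3 : |∑ i, ∑ j, negMulLog (p i j) - ∑ i, ∑ j, negMulLog (q i j)| ≤ k * ℓ * e := by
    simp only [← Finset.sum_sub_distrib]
    refine (Finset.abs_sum_le_sum_abs _ _).trans ?_
    refine (Finset.sum_le_sum fun i _ => (Finset.abs_sum_le_sum_abs _ _).trans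
      (Finset.sum_le_sum fun j _ => abs_negMulLog_sub_le (hp i j) (pe i j) (hq i j) (qe i j)
      hγ hγ1 (hpq i j))).trans ?_
    simp [he, mul_assoc]
  have hlog : 0 < log 2 := log_pos (by norm_num)
  rw [mutualInfo_eq_negMulLog hp, mutualInfo_eq_negMulLog hq, ← sub_div, abs_div,
    abs_of_pos hlog]
  gcongr
  have hk' : (1 : ℝ) ≤ k := by exact_mod_cast hk
  have hℓ' : (1 : ℝ) ≤ ℓ := by exact_mod_cast hℓ
  have c1 : k * e ≤ k * ℓ * e := by
    gcongr
    nlinarith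
  have c2 : ℓ * e ≤ k * ℓ * e := by
    gcongr
    nlinarith
  rw [abs_le] at *
  constructor <;> linarith [b1.1, b1.2, b2.1, b2.2, b3.1, b3.2]

theorem mutualInfo_transpose (p : Fin k → Fin ℓ → ℝ) :
    mutualInfo (fun j i => p i j) = mutualInfo p := by
  unfold mutualInfo
  rw [Finset.sum_comm]
  simp only [mul_comm]

theorem normMutualInfo_transpose (p : Fin k → Fin ℓ → ℝ) :
    normMutualInfo (fun j i => p i j) = normMutualInfo p := by
  rw [normMutualInfo, normMutualInfo, mutualInfo_transpose, min_comm]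

theorem mutualInfo_nonneg (hp : ∀ i j, 0 ≤ p i j) (hp1 : ∑ i, ∑ j, p i j ≤ 1) :
    0 ≤ mutualInfo p := by
  have hterm : ∀ i j, (p i j - (∑ j', p i j') * ∑ i', p i' j) / log 2 ≤
      p i j * logb 2 (p i j / ((∑ j', p i j') * ∑ i', p i' j)) := by
    intro i j
    have hlog : 0 < log 2 := log_pos (by norm_num)
    rw [logb, mul_div_assoc']
    gcongr
    rcases (hp i j).eq_or_lt with h | h
    · rw [← h, zero_mul, zero_sub]
      exact neg_nonpos.2 (mul_nonneg (Finset.sum_nonneg fun j _ => hp i j)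
        (Finset.sum_nonneg fun i _ => hp i j))
    · have hr : 0 < ∑ j', p i j' :=
        h.trans_le (Finset.single_le_sum (fun j _ => hp i j) (Finset.mem_univ j))
      have hc : 0 < ∑ i', p i' j :=
        h.trans_le (Finset.single_le_sum (f := fun i => p i j) (fun i _ => hp i j)
          (Finset.mem_univ i))
      have hh := one_sub_inv_le_log_of_pos (div_pos h (mul_pos hr hc))
      calc p i j - (∑ j', p i j') * ∑ i', p i' j
          = p i j * (1 - (p i j / ((∑ j', p i j') * ∑ i', p i' j))⁻¹) := by
            rw [inv_div]; field_simp
        _ ≤ _ := by gcongr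
  have hsum := Finset.sum_le_sum fun i (_ : i ∈ Finset.univ) =>
    Finset.sum_le_sum fun j (_ : j ∈ Finset.univ) => hterm i j
  refine le_trans ?_ hsum
  simp only [← Finset.sum_div, Finset.sum_sub_distrib, ← Finset.mul_sum, ← Finset.sum_mul]
  rw [Finset.sum_comm (f := fun j i => p i j)]
  have h0 : 0 ≤ ∑ i, ∑ j, p i j := Finset.sum_nonneg fun i _ => Finset.sum_nonneg fun j _ => hp i j
  have hlog : 0 < log 2 := log_pos (by norm_num)
  apply div_nonneg _ hlog.le
  -- With `s` the total mass, the remaining quantity is `s - s ^ 2`, nonnegative because `0 ≤ s ≤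
  -- 1`.
  nlinarith

/-- A joint mass is at most its row sum, so the column entropy is an upper bound. The extra `1`
allows for mass below one; the bound serves only to make the suprema finite. -/
theorem mutualInfo_le_log_add_one (hℓ : 1 ≤ ℓ) (hp : ∀ i j, 0 ≤ p i j)
    (hp1 : ∑ i, ∑ j, p i j ≤ 1) : mutualInfo p ≤ (log ℓ + 1) / log 2 := by
  have hlog : 0 < log 2 := log_pos (by norm_num)
  have hℓ0 : (0 : ℝ) < ℓ := by exact_mod_cast hℓ
  have hlℓ : 0 ≤ log (ℓ : ℝ) := log_nonneg (by exact_mod_cast hℓ)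
  have hterm : ∀ i j, p i j * log (p i j / ((∑ j', p i j') * ∑ i', p i' j)) ≤
      p i j * -log (∑ i', p i' j) := by
    intro i j
    rcases (hp i j).eq_or_lt with h | h
    · simp [← h]
    · have hle := Finset.single_le_sum (fun j _ => hp i j) (Finset.mem_univ j)
      have hr : 0 < ∑ j', p i j' := h.trans_le hle
      have hc : 0 < ∑ i', p i' j :=
        h.trans_le (Finset.single_le_sum (f := fun i => p i j) (fun i _ => hp i j)
          (Finset.mem_univ i))
      rw [← log_inv]
      gcongr
      rw [div_le_iff₀ (by positivity)]
      field_simp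
      exact hle
  have hcol : ∀ j, (∑ i, p i j) * -log (∑ i, p i j) ≤ (∑ i, p i j) * log ℓ + 1 / ℓ := by
    intro j
    rcases (Finset.sum_nonneg fun i (_ : i ∈ Finset.univ) => hp i j).eq_or_lt with h | h
    · rw [← h]; simp
    · have := log_le_sub_one_of_pos (inv_pos.2 (mul_pos hℓ0 h))
      rw [log_inv, log_mul hℓ0.ne' h.ne'] at this
      have h2 := mul_le_mul_of_nonneg_left this h.le
      have h3 : (∑ i, p i j) * ((ℓ * ∑ i, p i j)⁻¹ - 1) = 1 / ℓ - ∑ i, p i j := by field_simp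
      nlinarith
  have h1 : mutualInfo p = (∑ i, ∑ j, p i j * log (p i j / ((∑ j', p i j') * ∑ i', p i' j)))
      / log 2 := by
    simp only [mutualInfo, logb, mul_div_assoc', Finset.sum_div]
  rw [h1]
  gcongr
  calc _ ≤ ∑ i, ∑ j, p i j * -log (∑ i', p i' j) :=
        Finset.sum_le_sum fun i _ => Finset.sum_le_sum fun j _ => hterm i j
    _ = ∑ j, (∑ i, p i j) * -log (∑ i, p i j) := by
        rw [Finset.sum_comm]; simp only [Finset.sum_mul]
    _ ≤ ∑ j, ((∑ i, p i j) * log ℓ + 1 / ℓ) := Finset.sum_le_sum fun j _ => hcol j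
    _ = (∑ i, ∑ j, p i j) * log ℓ + 1 := by
        rw [Finset.sum_add_distrib, ← Finset.sum_mul, Finset.sum_comm]
        simp [hℓ0.ne']
    _ ≤ log ℓ + 1 := by nlinarith

theorem one_le_logb_min (hk : 2 ≤ k) (hℓ : 2 ≤ ℓ) : 1 ≤ logb 2 ((min k ℓ : ℕ) : ℝ) := by
  rw [le_logb_iff_rpow_le (by norm_num) (by positivity), rpow_one]
  exact_mod_cast le_min hk hℓ

theorem normMutualInfo_nonneg (hp : ∀ i j, 0 ≤ p i j) (hp1 : ∑ i, ∑ j, p i j ≤ 1) :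
    0 ≤ normMutualInfo p :=
  div_nonneg (mutualInfo_nonneg hp hp1)
    (div_nonneg (log_natCast_nonneg _) (log_nonneg (by norm_num)))

theorem normMutualInfo_le (hk : 2 ≤ k) (hℓ : 2 ≤ ℓ) (hp : ∀ i j, 0 ≤ p i j)
    (hp1 : ∑ i, ∑ j, p i j ≤ 1) : normMutualInfo p ≤ 1 + 1 / log 2 := by
  have hlog : 0 < log 2 := log_pos (by norm_num)
  have h1 := one_le_logb_min hk hℓ
  have hI : mutualInfo p ≤ (log ((min k ℓ : ℕ) : ℝ) + 1) / log 2 := by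
    rcases le_total k ℓ with h | h
    · rw [min_eq_left h, ← mutualInfo_transpose]
      refine mutualInfo_le_log_add_one (by omega) (fun j i => hp i j) ?_
      rwa [Finset.sum_comm]
    · rw [min_eq_right h]
      exact mutualInfo_le_log_add_one (by omega) hp hp1
  rw [normMutualInfo, div_le_iff₀ (by linarith)]
  rw [add_div] at hI
  change mutualInfo p ≤ logb 2 _ + _ at hI
  have : 0 < 1 / log 2 := by positivity
  nlinarith

theorem abs_normMutualInfo_sub_le (hk : 2 ≤ k) (hℓ : 2 ≤ ℓ) :
    |normMutualInfo p - normMutualInfo q| ≤ |mutualInfo p - mutualInfo q| := by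
  have h1 := one_le_logb_min hk hℓ
  rw [normMutualInfo, normMutualInfo, ← sub_div, abs_div]
  exact div_le_self (abs_nonneg _) (h1.trans (le_abs_self _))

/-- Data processing inequality. Termwise, `log x ≥ 1 - 1 / x` is applied to the ratio of the
conditional probability of row `i` given column `e` to the one given the merged column `a e`; the
correction terms have nonnegative sum over the rows. -/
theorem mutualInfo_merge_le {M : ℕ} (p : Fin k → Fin M → ℝ) (hp : ∀ i e, 0 ≤ p i e)
    (a : Fin M → Fin ℓ) :
    mutualInfo (fun i j => ∑ e with a e = j, p i e) ≤ mutualInfo p := by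
  set q : Fin k → Fin ℓ → ℝ := fun i j => ∑ e with a e = j, p i e with hq
  have hlog : 0 < log 2 := log_pos (by norm_num)
  have hrow : ∀ i, ∑ j, q i j = ∑ e, p i e := fun i =>
    Finset.sum_fiberwise Finset.univ a (p i)
  have hq0 : ∀ i j, 0 ≤ q i j := fun i j => Finset.sum_nonneg fun e _ => hp i e
  have hpq : ∀ i e, p i e ≤ q i (a e) := fun i e =>
    Finset.single_le_sum (fun e _ => hp i e) (by simp)
  have hq_eq : mutualInfo q =
      ∑ i, ∑ e, p i e * logb 2 (q i (a e) / ((∑ e', p i e') * ∑ i', q i' (a e))) := by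
    unfold mutualInfo
    refine Finset.sum_congr rfl fun i _ => ?_
    rw [← Finset.sum_fiberwise Finset.univ a]
    refine Finset.sum_congr rfl fun j _ => ?_
    rw [hrow, hq, Finset.sum_mul]
    refine Finset.sum_congr rfl fun e he => ?_
    rw [(Finset.mem_filter.1 he).2]
  have hterm : ∀ i e, p i e * logb 2 (q i (a e) / ((∑ e', p i e') * ∑ i', q i' (a e))) +
      (p i e - (∑ i', p i' e) * (q i (a e) / ∑ i', q i' (a e))) / log 2 ≤
      p i e * logb 2 (p i e / ((∑ e', p i e') * ∑ i', p i' e)) := by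
    intro i e
    rw [logb, logb, mul_div_assoc' (p i e), mul_div_assoc' (p i e), ← add_div]
    gcongr
    have hc0 : 0 ≤ ∑ i', p i' e := Finset.sum_nonneg fun i _ => hp i e
    have hc0' : 0 ≤ ∑ i', q i' (a e) := Finset.sum_nonneg fun i _ => hq0 i _
    rcases (hp i e).eq_or_lt with h | h
    · rw [← h, zero_mul, zero_mul, zero_add, zero_sub]
      exact neg_nonpos.2 (mul_nonneg hc0 (div_nonneg (hq0 _ _) hc0'))
    · have hr : 0 < ∑ e', p i e' :=
        h.trans_le (Finset.single_le_sum (fun j _ => hp i j) (Finset.mem_univ e))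
      have hc : 0 < ∑ i', p i' e :=
        h.trans_le (Finset.single_le_sum (f := fun i => p i e) (fun i _ => hp i e)
          (Finset.mem_univ i))
      have hqe : 0 < q i (a e) := h.trans_le (hpq i e)
      have hc' : 0 < ∑ i', q i' (a e) :=
        hqe.trans_le (Finset.single_le_sum (f := fun i => q i (a e)) (fun i _ => hq0 i _)
          (Finset.mem_univ i))
      have hh := one_sub_inv_le_log_of_pos (x := (p i e * ∑ i', q i' (a e)) /
        ((∑ i', p i' e) * q i (a e))) (by positivity)
      rw [log_div (by positivity) (by positivity), log_mul h.ne' hc'.ne',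
        log_mul hc.ne' hqe.ne'] at hh
      rw [log_div h.ne' (by positivity), log_div hqe.ne' (by positivity),
        log_mul hr.ne' hc.ne', log_mul hr.ne' hc'.ne']
      have h2 := mul_le_mul_of_nonneg_left hh h.le
      have h3 : p i e * (1 - ((p i e * ∑ i', q i' (a e)) / ((∑ i', p i' e) * q i (a e)))⁻¹)
          = p i e - (∑ i', p i' e) * (q i (a e) / ∑ i', q i' (a e)) := by
        rw [inv_div]; field_simp
      rw [h3] at h2
      linarith
  have hsum := Finset.sum_le_sum fun i (_ : i ∈ Finset.univ) =>
    Finset.sum_le_sum fun e (_ : e ∈ Finset.univ) => hterm i e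
  simp only [Finset.sum_add_distrib, ← Finset.sum_div] at hsum
  rw [← hq_eq] at hsum
  have hpos : 0 ≤ (∑ i, ∑ e, (p i e - (∑ i', p i' e) * (q i (a e) / ∑ i', q i' (a e))))
      / log 2 := by
    apply div_nonneg _ hlog.le
    rw [Finset.sum_comm]
    refine Finset.sum_nonneg fun e _ => ?_
    rw [Finset.sum_sub_distrib, ← Finset.mul_sum, ← Finset.sum_div]
    have hc0 : 0 ≤ ∑ i', p i' e := Finset.sum_nonneg fun i _ => hp i e
    have : (∑ i, q i (a e)) / ∑ i', q i' (a e) ≤ 1 := div_self_le_one _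
    nlinarith
  exact (le_add_of_nonneg_right hpos).trans hsum

theorem tendsto_mutualInfo {ι : Type*} {l : Filter ι} {u : ι → Fin k → Fin ℓ → ℝ}
    (hu : ∀ n i j, 0 ≤ u n i j) (hp : ∀ i j, 0 ≤ p i j)
    (h : ∀ i j, Tendsto (fun n => u n i j) l (𝓝 (p i j))) :
    Tendsto (fun n => mutualInfo (u n)) l (𝓝 (mutualInfo p)) := by
  simp only [mutualInfo_eq_negMulLog (hu _), mutualInfo_eq_negMulLog hp]
  refine Tendsto.div_const (Tendsto.sub (Tendsto.add ?_ ?_) ?_) _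
  · exact tendsto_finsetSum _ fun i _ => (continuous_negMulLog.tendsto _).comp
      (tendsto_finsetSum _ fun j _ => h i j)
  · exact tendsto_finsetSum _ fun j _ => (continuous_negMulLog.tendsto _).comp
      (tendsto_finsetSum _ fun i _ => h i j)
  · exact tendsto_finsetSum _ fun i _ => tendsto_finsetSum _ fun j _ =>
      (continuous_negMulLog.tendsto _).comp (h i j)

theorem mutualInfo_comp_rows {k' : ℕ} {e : Fin k' → Fin k} (he : Function.Injective e)
    (h0 : ∀ i ∉ Set.range e, ∀ j, p i j = 0) : mutualInfo (fun i => p (e i)) = mutualInfo p := by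
  have hc : ∀ j, ∑ i, p (e i) j = ∑ i, p i j := fun j =>
    Fintype.sum_of_injective e he _ _ (fun i hi => h0 i hi j) fun _ => rfl
  unfold mutualInfo
  refine Fintype.sum_of_injective e he _ _ (fun i hi => ?_) fun i => ?_
  · simp [h0 i hi]
  · simp only [hc]

end Discrete

/-! ### Interval partitions and range equipartitions. -/

section Partitions

variable {k ℓ : ℕ} {S T : Set ℝ} {R : Fin k → Set ℝ}

theorem IsIntervalPartition.measurableSet (h : IsIntervalPartition S R) (i : Fin k) :
    MeasurableSet (R i) :=
  (h.interval i).measurableSet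

theorem IsIntervalPartition.measurableSet_union (h : IsIntervalPartition S R) :
    MeasurableSet S :=
  h.cover ▸ MeasurableSet.iUnion h.measurableSet

theorem isIntervalPartition_rangeEquipartition {a b : ℝ} (hab : a < b) (hℓ : 1 ≤ ℓ) :
    IsIntervalPartition (Set.Icc a b) (rangeEquipartition a b ℓ) := by
  have hℓ0 : (0 : ℝ) < ℓ := by exact_mod_cast hℓ
  obtain ⟨w, hw⟩ : ∃ w, w = (b - a) / ℓ := ⟨_, rfl⟩
  have hw0 : 0 < w := hw ▸ div_pos (by linarith) hℓ0
  have hwℓ : ℓ * w = b - a := by rw [hw]; field_simp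
  have hmem : ∀ j : Fin ℓ, ∀ t, t ∈ rangeEquipartition a b ℓ j ↔ a + j * w ≤ t ∧
      (t < a + ((j : ℝ) + 1) * w ∨ ((j : ℕ) + 1 = ℓ ∧ t = b)) := fun j t => by
    rw [hw]; exact Iff.rfl
  have hlast : ∀ j : Fin ℓ, (j : ℕ) + 1 = ℓ → a + ((j : ℝ) + 1) * w = b := fun j hj => by
    have : ((j : ℝ) + 1) = ℓ := by exact_mod_cast hj
    rw [this, hwℓ]; ring
  have hle : ∀ j : Fin ℓ, a + ((j : ℝ) + 1) * w ≤ b := fun j => by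
    have : ((j : ℝ) + 1) ≤ ℓ := by exact_mod_cast j.2
    nlinarith
  refine ⟨fun j => ⟨a + j * w, (hmem j _).2 ⟨le_rfl, Or.inl (by nlinarith)⟩⟩, fun j => ?_, ?_, ?_⟩
  · refine ⟨fun x hx y hy z hz => ?_⟩
    rw [hmem] at *
    refine ⟨hx.1.trans hz.1, ?_⟩
    rcases hy.2 with h | ⟨h, rfl⟩
    · exact Or.inl (hz.2.trans_lt h)
    · rcases hz.2.eq_or_lt with h' | h'
      · exact Or.inr ⟨h, h'⟩
      · exact Or.inl (by rwa [hlast j h])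
  · have key : ∀ i j : Fin ℓ, i < j →
        Disjoint (rangeEquipartition a b ℓ i) (rangeEquipartition a b ℓ j) := by
      intro i j hij
      rw [Set.disjoint_left]
      intro t hi hj
      rw [hmem] at hi hj
      have h1 : ((i : ℝ) + 1) ≤ j := by exact_mod_cast hij
      rcases hi.2 with h | ⟨h, -⟩
      · nlinarith [hj.1]
      · have := j.2
        have : (i : ℕ) < j := hij
        omega
    intro i j hij
    rcases lt_or_gt_of_ne hij with h | h
    · exact key i j h
    · exact (key j i h).symm
  · ext t
    simp only [Set.mem_iUnion, hmem, Set.mem_Icc]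
    constructor
    · rintro ⟨j, h1, h2⟩
      have : 0 ≤ (j : ℝ) * w := by positivity
      refine ⟨by linarith, ?_⟩
      rcases h2 with h | ⟨-, rfl⟩
      · exact h.le.trans (hle j)
      · exact le_rfl
    · rintro ⟨h1, h2⟩
      rcases h2.eq_or_lt with rfl | h2
      · refine ⟨⟨ℓ - 1, by omega⟩, ?_, Or.inr ⟨by simp; omega, rfl⟩⟩
        have h := hle ⟨ℓ - 1, by omega⟩
        nlinarith
      · have h0 : 0 ≤ (t - a) / w := div_nonneg (by linarith) hw0.le
        have hlt : ⌊(t - a) / w⌋₊ < ℓ := by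
          rw [Nat.floor_lt h0, div_lt_iff₀ hw0]
          linarith
        refine ⟨⟨_, hlt⟩, ?_, Or.inl ?_⟩
        · have := Nat.floor_le h0
          rw [le_div_iff₀ hw0] at this
          simp only
          linarith
        · have := Nat.lt_floor_add_one ((t - a) / w)
          rw [div_lt_iff₀ hw0] at this
          simp only
          linarith

theorem IsIntervalPartition.exists_extension {a b : ℝ} (hab : a ≤ b)
    (h : IsIntervalPartition (Set.Icc a b) R) :
    ∃ R' : Fin k → Set ℝ, IsIntervalPartition Set.univ R' ∧
      ∀ i, ∀ t ∈ Set.Icc a b, t ∈ R' i ↔ t ∈ R i := by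
  have hfix : ∀ t ∈ Set.Icc a b, max a (min b t) = t := fun t ht => by
    rw [min_eq_right ht.2, max_eq_right ht.1]
  have hsub : ∀ i, R i ⊆ Set.Icc a b := fun i => h.cover ▸ Set.subset_iUnion R i
  -- Pull back along the monotone retraction of the line onto `[a, b]`.
  refine ⟨fun i => (fun t => max a (min b t)) ⁻¹' R i, ⟨fun i => ?_, fun i => ?_, ?_, ?_⟩, ?_⟩
  · obtain ⟨t, ht⟩ := h.nonempty i
    exact ⟨t, by rw [Set.mem_preimage, hfix t (hsub i ht)]; exact ht⟩
  · exact (h.interval i).preimage_mono fun x y hxy => by gcongr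
  · exact fun i j hij => (h.disjoint hij).preimage _
  · rw [← Set.preimage_iUnion, h.cover, Set.eq_univ_iff_forall]
    exact fun t => ⟨le_max_left _ _, max_le hab (min_le_left _ _)⟩
  · intro i t ht
    rw [Set.mem_preimage, hfix t ht]

theorem isIntervalPartition_of_mem_rangeGrids {L : PlaneRange} (hk : 1 ≤ k) (hℓ : 1 ≤ ℓ)
    {G : Grid k ℓ} (hG : G ∈ rangeGrids L k ℓ) :
    IsIntervalPartition (Set.Icc L.y₀ L.y₁) G.1 ∧ IsIntervalPartition (Set.Icc L.x₀ L.x₁) G.2 := by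
  rcases hG with ⟨-, h, h'⟩ | ⟨-, h, h'⟩
  · exact ⟨h', h ▸ isIntervalPartition_rangeEquipartition L.hx hℓ⟩
  · exact ⟨h ▸ isIntervalPartition_rangeEquipartition L.hy hk, h'⟩

theorem equipartition_mem_rangeGrids (L : PlaneRange) (hk : 1 ≤ k) (hℓ : 1 ≤ ℓ) :
    ((rangeEquipartition L.y₀ L.y₁ k, rangeEquipartition L.x₀ L.x₁ ℓ) : Grid k ℓ) ∈
      rangeGrids L k ℓ := by
  rcases le_or_gt k ℓ with h | h
  · exact Or.inl ⟨h, rfl, isIntervalPartition_rangeEquipartition L.hy hk⟩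
  · exact Or.inr ⟨h, rfl, isIntervalPartition_rangeEquipartition L.hx hℓ⟩

end Partitions

/-! ### Cell masses of measures, empirical measures, and bounds on the suprema. -/

section Matrices

variable {k ℓ : ℕ} {S T : Set ℝ} {G : Grid k ℓ} {ν : Measure (ℝ × ℝ)} [IsFiniteMeasure ν]

theorem distMatrix_nonneg (ν : Measure (ℝ × ℝ)) (G : Grid k ℓ) (i : Fin k) (j : Fin ℓ) :
    0 ≤ distMatrix ν G i j := measureReal_nonneg

theorem measurableSet_cell (h1 : IsIntervalPartition S G.1) (h2 : IsIntervalPartition T G.2)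
    (i : Fin k) (j : Fin ℓ) : MeasurableSet (cell G i j) :=
  (h2.measurableSet j).prod (h1.measurableSet i)

theorem sum_distMatrix_row (h1 : IsIntervalPartition S G.1) (h2 : IsIntervalPartition T G.2)
    (i : Fin k) : ∑ j, distMatrix ν G i j = ν.real (T ×ˢ G.1 i) := by
  unfold distMatrix
  rw [← measureReal_iUnion_fintype _ (measurableSet_cell h1 h2 i)]
  · simp only [cell]
    rw [← Set.iUnion_prod_const, h2.cover]
  · exact fun j j' hjj => Set.disjoint_prod.2 (Or.inl (h2.disjoint hjj))

theorem sum_distMatrix_col (h1 : IsIntervalPartition S G.1) (h2 : IsIntervalPartition T G.2)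
    (j : Fin ℓ) : ∑ i, distMatrix ν G i j = ν.real (G.2 j ×ˢ S) := by
  unfold distMatrix
  rw [← measureReal_iUnion_fintype _ (fun i => measurableSet_cell h1 h2 i j)]
  · simp only [cell]
    rw [← Set.prod_iUnion, h1.cover]
  · exact fun i i' hii => Set.disjoint_prod.2 (Or.inr (h1.disjoint hii))

theorem sum_distMatrix_le_one (hν : ν.real Set.univ ≤ 1) (h1 : IsIntervalPartition S G.1)
    (h2 : IsIntervalPartition T G.2) : ∑ i, ∑ j, distMatrix ν G i j ≤ 1 := by
  have : ∑ i, ∑ j, distMatrix ν G i j = ν.real (T ×ˢ S) := by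
    simp only [sum_distMatrix_row h1 h2]
    rw [← measureReal_iUnion_fintype, ← Set.prod_iUnion, h1.cover]
    · exact fun i i' hii => Set.disjoint_prod.2 (Or.inr (h1.disjoint hii))
    · exact fun i => h2.measurableSet_union.prod (h1.measurableSet i)
  rw [this]
  exact (measureReal_mono (Set.subset_univ _)).trans hν

/-- The empirical measure of a list of points. -/
noncomputable def empMeasure {E : Type*} [MeasurableSpace E] {n : ℕ} (D : Fin n → E) : Measure E :=
  (n : ENNReal)⁻¹ • ∑ m, Measure.dirac (D m)

/-- Only an inequality: for `n = 0` the empirical measure is zero. -/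
theorem empMeasure_univ_le {E : Type*} [MeasurableSpace E] {n : ℕ} (D : Fin n → E) :
    empMeasure D Set.univ ≤ 1 := by
  simp [empMeasure, ENNReal.inv_mul_le_one]

instance {E : Type*} [MeasurableSpace E] {n : ℕ} (D : Fin n → E) :
    IsFiniteMeasure (empMeasure D) :=
  ⟨(empMeasure_univ_le D).trans_lt ENNReal.one_lt_top⟩

theorem empMeasure_real_univ_le {E : Type*} [MeasurableSpace E] {n : ℕ} (D : Fin n → E) :
    (empMeasure D).real Set.univ ≤ 1 :=
  ENNReal.toReal_le_of_le_ofReal zero_le_one (by simpa using empMeasure_univ_le D)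

theorem empMeasure_real_apply {E : Type*} [MeasurableSpace E] {n : ℕ} (D : Fin n → E)
    {A : Set E} (hA : MeasurableSet A) :
    (empMeasure D).real A = (1 / (n : ℝ)) * ∑ m, A.indicator 1 (D m) := by
  rw [Measure.real, empMeasure, Measure.smul_apply, Measure.finsetSum_apply, smul_eq_mul,
    ENNReal.toReal_mul, ENNReal.toReal_sum]
  · simp only [Measure.dirac_apply' _ hA, one_div, ENNReal.toReal_inv, ENNReal.toReal_natCast]
    congr 2 with m
    by_cases h : D m ∈ A <;> simp [h]
  · intro m _
    finiteness

theorem sampleMatrix_eq_distMatrix {n : ℕ} (D : Fin n → ℝ × ℝ) (h1 : IsIntervalPartition S G.1)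
    (h2 : IsIntervalPartition T G.2) : sampleMatrix D G = distMatrix (empMeasure D) G := by
  classical
  ext i j
  rw [distMatrix, empMeasure_real_apply D (measurableSet_cell h1 h2 i j), sampleMatrix]
  congr 1
  rw [Finset.card_filter, Nat.cast_sum]
  refine Finset.sum_congr rfl fun m _ => ?_
  by_cases h : D m ∈ cell G i j <;> simp [h]

theorem normMutualInfo_sampleMatrix_le {L : PlaneRange} {n : ℕ} (D : Fin n → ℝ × ℝ)
    (hk : 2 ≤ k) (hℓ : 2 ≤ ℓ) (hG : G ∈ rangeGrids L k ℓ) :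
    normMutualInfo (sampleMatrix D G) ≤ 1 + 1 / Real.log 2 := by
  obtain ⟨h1, h2⟩ := isIntervalPartition_of_mem_rangeGrids (by omega) (by omega) hG
  rw [sampleMatrix_eq_distMatrix D h1 h2]
  exact normMutualInfo_le hk hℓ (distMatrix_nonneg _ _)
    (sum_distMatrix_le_one (empMeasure_real_univ_le D) h1 h2)

theorem normMutualInfo_sampleMatrix_le_micrUnconstrained {L : PlaneRange} {n : ℕ}
    (D : Fin n → ℝ × ℝ) {B : ℝ} (hk : 2 ≤ k) (hℓ : 2 ≤ ℓ) (hB : ((k * ℓ : ℕ) : ℝ) ≤ B)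
    (hG : G ∈ rangeGrids L k ℓ) :
    normMutualInfo (sampleMatrix D G) ≤ micrUnconstrained D L B := by
  have h1 : normMutualInfo (sampleMatrix D G) ≤ rangeEntry D L k ℓ := by
    refine le_csSup ⟨1 + 1 / Real.log 2, ?_⟩ ⟨G, hG, rfl⟩
    rintro _ ⟨G', hG', rfl⟩
    exact normMutualInfo_sampleMatrix_le D hk hℓ hG'
  refine h1.trans (le_csSup ⟨1 + 1 / Real.log 2, ?_⟩ ⟨k, ℓ, hk, hℓ, hB, rfl⟩)
  rintro _ ⟨k', ℓ', hk', hℓ', -, rfl⟩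
  refine csSup_le ⟨_, _, equipartition_mem_rangeGrids L (by omega) (by omega), rfl⟩ ?_
  rintro _ ⟨G', hG', rfl⟩
  exact normMutualInfo_sampleMatrix_le D hk' hℓ' hG'

theorem micrUnconstrained_le {L : PlaneRange} {n : ℕ} (D : Fin n → ℝ × ℝ) {B c : ℝ} (hB : 4 ≤ B)
    (h : ∀ k ℓ : ℕ, 2 ≤ k → 2 ≤ ℓ → ((k * ℓ : ℕ) : ℝ) ≤ B → ∀ G ∈ rangeGrids L k ℓ,
      normMutualInfo (sampleMatrix D G) ≤ c) : micrUnconstrained D L B ≤ c := by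
  -- The bound `4 ≤ B` admits the size `2 × 2`, so the supremum is not over the empty set.
  refine csSup_le ⟨_, 2, 2, le_rfl, le_rfl, by norm_num; exact hB, rfl⟩ ?_
  rintro _ ⟨k, ℓ, hk, hℓ, hkℓ, rfl⟩
  refine csSup_le ⟨_, _, equipartition_mem_rangeGrids L (by omega) (by omega), rfl⟩ ?_
  rintro _ ⟨G, hG, rfl⟩
  exact h k ℓ hk hℓ hkℓ G hG

theorem exists_mem_allGrids_distMatrix_eq {ρ : Measure (ℝ × ℝ)} {L : PlaneRange} (hν : ∀ᵐ z ∂ρ, z ∈ L.toSet)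
    (h1 : IsIntervalPartition (Set.Icc L.y₀ L.y₁) G.1)
    (h2 : IsIntervalPartition (Set.Icc L.x₀ L.x₁) G.2) :
    ∃ G' ∈ allGrids k ℓ, distMatrix ρ G' = distMatrix ρ G := by
  obtain ⟨P', hP, hP'⟩ := h1.exists_extension L.hy.le
  obtain ⟨Q', hQ, hQ'⟩ := h2.exists_extension L.hx.le
  refine ⟨(P', Q'), ⟨hP, hQ⟩, ?_⟩
  ext i j
  refine measureReal_congr ?_
  filter_upwards [hν] with z hz
  exact propext (and_congr (hQ' j z.1 hz.1) (hP' i z.2 hz.2))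

theorem normMutualInfo_distMatrix_le [IsProbabilityMeasure ν] (hk : 2 ≤ k) (hℓ : 2 ≤ ℓ)
    (hG : G ∈ allGrids k ℓ) : normMutualInfo (distMatrix ν G) ≤ 1 + 1 / Real.log 2 :=
  normMutualInfo_le hk hℓ (distMatrix_nonneg _ _) (sum_distMatrix_le_one (by simp) hG.1 hG.2)

theorem allGrids_nonempty (hk : 1 ≤ k) (hℓ : 1 ≤ ℓ) : (allGrids k ℓ).Nonempty := by
  obtain ⟨P, hP, -⟩ := (isIntervalPartition_rangeEquipartition zero_lt_one hk).exists_extension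
    zero_le_one
  obtain ⟨Q, hQ, -⟩ := (isIntervalPartition_rangeEquipartition zero_lt_one hℓ).exists_extension
    zero_le_one
  exact ⟨(P, Q), hP, hQ⟩

theorem normMutualInfo_le_micStar [IsProbabilityMeasure ν] {L : PlaneRange}
    (hν : ∀ᵐ z ∂ν, z ∈ L.toSet) (hk : 2 ≤ k) (hℓ : 2 ≤ ℓ) (hG : G ∈ rangeGrids L k ℓ) :
    normMutualInfo (distMatrix ν G) ≤ micStar ν := by
  obtain ⟨h1, h2⟩ := isIntervalPartition_of_mem_rangeGrids (by omega) (by omega) hG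
  obtain ⟨G', hG', he⟩ := exists_mem_allGrids_distMatrix_eq hν h1 h2
  rw [← he]
  have h3 : normMutualInfo (distMatrix ν G') ≤ charEntry ν k ℓ := by
    refine le_csSup ⟨1 + 1 / Real.log 2, ?_⟩ ⟨G', hG', rfl⟩
    rintro _ ⟨G', hG', rfl⟩
    exact normMutualInfo_distMatrix_le hk hℓ hG'
  refine h3.trans (le_csSup ⟨1 + 1 / Real.log 2, ?_⟩ ⟨k, ℓ, hk, hℓ, rfl⟩)
  rintro _ ⟨k', ℓ', hk', hℓ', rfl⟩
  refine csSup_le ((allGrids_nonempty (by omega) (by omega)).image _) ?_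
  rintro _ ⟨G', hG', rfl⟩
  exact normMutualInfo_distMatrix_le hk' hℓ' hG'

theorem exists_micStar_sub_lt (ν : Measure (ℝ × ℝ)) {ε : ℝ} (hε : 0 < ε) :
    ∃ k ℓ : ℕ, 2 ≤ k ∧ 2 ≤ ℓ ∧ ∃ G ∈ allGrids k ℓ,
      micStar ν - ε < normMutualInfo (distMatrix ν G) := by
  obtain ⟨_, ⟨k, ℓ, hk, hℓ, rfl⟩, h⟩ := exists_lt_of_lt_csSup
    (s := {m | ∃ k ℓ : ℕ, 2 ≤ k ∧ 2 ≤ ℓ ∧ m = charEntry ν k ℓ})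
    ⟨_, 2, 2, le_rfl, le_rfl, rfl⟩ (sub_lt_self (micStar ν) hε)
  obtain ⟨_, ⟨G, hG, rfl⟩, h'⟩ := exists_lt_of_lt_csSup
    ((allGrids_nonempty (by omega) (by omega)).image _) h
  exact ⟨k, ℓ, hk, hℓ, G, hG, h'⟩

theorem abs_normMutualInfo_distMatrix_sub_le {ν' : Measure (ℝ × ℝ)} [IsFiniteMeasure ν']
    {δ γ : ℝ} (hγ : 0 < γ) (hγ1 : γ < 1) (hk : 2 ≤ k) (hℓ : 2 ≤ ℓ) (hδ : 0 ≤ δ)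
    (hν : ν.real Set.univ ≤ 1) (hν' : ν'.real Set.univ ≤ 1)
    (h1 : IsIntervalPartition S G.1) (h2 : IsIntervalPartition T G.2)
    (hcell : ∀ i j, |ν.real (G.2 j ×ˢ G.1 i) - ν'.real (G.2 j ×ˢ G.1 i)| ≤ δ)
    (hrow : ∀ i, |ν.real (T ×ˢ G.1 i) - ν'.real (T ×ˢ G.1 i)| ≤ δ)
    (hcol : ∀ j, |ν.real (G.2 j ×ˢ S) - ν'.real (G.2 j ×ˢ S)| ≤ δ) :
    |normMutualInfo (distMatrix ν G) - normMutualInfo (distMatrix ν' G)| ≤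
      3 * (k * ℓ) * (δ ^ (1 - γ) / γ) / Real.log 2 := by
  refine (abs_normMutualInfo_sub_le hk hℓ).trans (abs_mutualInfo_sub_le hγ hγ1 (by omega)
    (by omega) hδ (distMatrix_nonneg _ _) (distMatrix_nonneg _ _) (sum_distMatrix_le_one hν h1 h2)
    (sum_distMatrix_le_one hν' h1 h2) hcell (fun i => ?_) fun j => ?_)
  · simpa only [sum_distMatrix_row h1 h2] using hrow i
  · simpa only [sum_distMatrix_col h1 h2] using hcol j

end Matrices

/-! ### Finite bracketing of all intervals of the line. -/

section Brackets

/-- The family may be uncountable, but lower sets form a chain. Unless one member is the whole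
union, every point of the union lies below a rational of the union, so the union is a countable
directed union of rays, each inside a member. -/
theorem measure_sUnion_le_of_isLowerSet (ρ : Measure ℝ) {F : Set (Set ℝ)} {c : ENNReal}
    (hF : ∀ S ∈ F, IsLowerSet S) (hc : ∀ S ∈ F, ρ S ≤ c) : ρ (⋃₀ F) ≤ c := by
  by_cases h : ∃ S ∈ F, ⋃₀ F ⊆ S
  · obtain ⟨S, hS, hle⟩ := h
    exact (measure_mono hle).trans (hc S hS)
  · push Not at h
    have heq : ⋃₀ F = ⋃ q : {q : ℚ // (q : ℝ) ∈ ⋃₀ F}, Set.Iic ((q : ℚ) : ℝ) := by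
      ext x
      simp only [Set.mem_iUnion, Set.mem_Iic]
      constructor
      · rintro ⟨S, hS, hx⟩
        obtain ⟨y, hy, hyS⟩ := Set.not_subset.1 (h S hS)
        have hxy : x < y := lt_of_not_ge fun hyx => hyS (hF S hS hyx hx)
        obtain ⟨q, hxq, hqy⟩ := exists_rat_btwn hxy
        exact ⟨⟨q, isLowerSet_sUnion hF hqy.le hy⟩, hxq.le⟩
      · rintro ⟨q, hq⟩
        exact isLowerSet_sUnion hF hq q.2
    rw [heq, Directed.measure_iUnion]
    · refine iSup_le fun q => ?_
      obtain ⟨S, hS, hq⟩ := q.2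
      exact (measure_mono fun x hx => hF S hS hx hq).trans (hc S hS)
    · refine Monotone.directed_le fun p q hpq => Set.Iic_subset_Iic.2 ?_
      exact_mod_cast hpq

theorem measure_sUnion_le_of_isUpperSet (ρ : Measure ℝ) {F : Set (Set ℝ)} {c : ENNReal}
    (hF : ∀ S ∈ F, IsUpperSet S) (hc : ∀ S ∈ F, ρ S ≤ c) : ρ (⋃₀ F) ≤ c := by
  have hmap : ∀ S, (ρ.map (MeasurableEquiv.neg ℝ)) (Neg.neg ⁻¹' S) = ρ S := fun S => by
    rw [MeasurableEquiv.map_apply]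
    congr 1
    ext x
    simp
  have h := measure_sUnion_le_of_isLowerSet (ρ.map (MeasurableEquiv.neg ℝ))
    (F := (fun S => Neg.neg ⁻¹' S) '' F) (c := c) ?_ ?_
  · rwa [Set.sUnion_image, ← Set.preimage_iUnion₂, ← Set.sUnion_eq_biUnion, hmap] at h
  · rintro _ ⟨S, hS, rfl⟩ x y hyx hx
    exact hF S hS (neg_le_neg hyx) hx
  · rintro _ ⟨S, hS, rfl⟩
    exact (hmap S).trans_le (hc S hS)

theorem le_measure_sInter_of_isLowerSet (ρ : Measure ℝ) [IsProbabilityMeasure ρ]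
    {F : Set (Set ℝ)} {c : ℝ} (hF : ∀ S ∈ F, IsLowerSet S) (hc : ∀ S ∈ F, c ≤ ρ.real S)
    (hc1 : c ≤ 1) : c ≤ ρ.real (⋂₀ F) := by
  have hmeas : ∀ S : Set ℝ, IsLowerSet S → MeasurableSet S := fun S hS =>
    hS.ordConnected.measurableSet
  have h := measure_sUnion_le_of_isUpperSet ρ (F := compl '' F) (c := ENNReal.ofReal (1 - c))
    ?_ ?_
  · rw [← Set.compl_sInter] at h
    have h2 := ENNReal.toReal_le_of_le_ofReal (by linarith) h
    change ρ.real _ ≤ _ at h2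
    rw [probReal_compl_eq_one_sub (hmeas _ (isLowerSet_sInter hF))] at h2
    linarith
  · rintro _ ⟨S, hS, rfl⟩
    exact (hF S hS).compl
  · rintro _ ⟨S, hS, rfl⟩
    rw [← ofReal_measureReal (by finiteness), probReal_compl_eq_one_sub (hmeas S (hF S hS))]
    exact ENNReal.ofReal_le_ofReal (by linarith [hc S hS])

/-- Finitely many lower sets bracket all lower sets of the real line up to a small mass. -/
theorem exists_lowerSet_brackets (ρ : Measure ℝ) [IsProbabilityMeasure ρ] {m : ℕ} (hm : 0 < m) :
    ∃ F : Fin (m + 1) × Bool → Set ℝ, (∀ a, MeasurableSet (F a)) ∧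
      ∀ S, IsLowerSet S → ∃ a b, F a ⊆ S ∧ S ⊆ F b ∧ ρ.real (F b \ F a) ≤ 1 / m := by
  have hm0 : (0 : ℝ) < m := by exact_mod_cast hm
  -- The brackets of `S` are `⋂₀ D i` and `⋃₀ U i` with `i = ⌊m * ρ S⌋`. They have masses at least
  -- `i / m` and at most `(i + 1) / m` even if `ρ` has atoms; the index `i = m` serves mass one.
  let U : Fin (m + 1) → Set (Set ℝ) := fun i => {S | IsLowerSet S ∧ ρ.real S < (i + 1) / m}
  let D : Fin (m + 1) → Set (Set ℝ) := fun i => {S | IsLowerSet S ∧ i / m ≤ ρ.real S}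
  have hUl : ∀ i, IsLowerSet (⋃₀ U i) := fun i => isLowerSet_sUnion fun S hS => hS.1
  have hDl : ∀ i, IsLowerSet (⋂₀ D i) := fun i => isLowerSet_sInter fun S hS => hS.1
  have hU : ∀ i, ρ.real (⋃₀ U i) ≤ (i + 1) / m := fun i => by
    refine ENNReal.toReal_le_of_le_ofReal (by positivity)
      (measure_sUnion_le_of_isLowerSet ρ (fun S hS => hS.1) fun S hS => ?_)
    rw [← ofReal_measureReal (by finiteness)]
    exact ENNReal.ofReal_le_ofReal hS.2.le
  have hD : ∀ i : Fin (m + 1), i / m ≤ ρ.real (⋂₀ D i) := fun i => by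
    refine le_measure_sInter_of_isLowerSet ρ (fun S hS => hS.1) (fun S hS => hS.2) ?_
    rw [div_le_one hm0]
    exact_mod_cast Nat.lt_succ_iff.1 i.2
  refine ⟨fun a => bif a.2 then ⋃₀ U a.1 else ⋂₀ D a.1, fun ⟨i, b⟩ => ?_, fun S hS => ?_⟩
  · cases b
    · exact (hDl i).ordConnected.measurableSet
    · exact (hUl i).ordConnected.measurableSet
  · have h0 : 0 ≤ m * ρ.real S := by positivity
    have hi : ⌊m * ρ.real S⌋₊ < m + 1 := by
      rw [Nat.lt_succ_iff]
      refine Nat.floor_le_of_le ?_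
      have : ρ.real S ≤ 1 := measureReal_le_one
      nlinarith
    have h1 := Nat.floor_le h0
    have h2 := Nat.lt_floor_add_one (m * ρ.real S)
    set i : Fin (m + 1) := ⟨⌊m * ρ.real S⌋₊, hi⟩
    have hSU : S ∈ U i := ⟨hS, by rw [lt_div_iff₀ hm0]; linarith⟩
    have hSD : S ∈ D i := ⟨hS, by rw [div_le_iff₀ hm0]; linarith⟩
    have hs1 : ⋂₀ D i ⊆ S := Set.sInter_subset_of_mem hSD
    have hs2 : S ⊆ ⋃₀ U i := Set.subset_sUnion_of_mem hSU
    refine ⟨(i, false), (i, true), hs1, hs2, ?_⟩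
    simp only [cond_true, cond_false]
    rw [measureReal_sdiff (hs1.trans hs2) (hDl i).ordConnected.measurableSet]
    have := hU i
    have := hD i
    have : ((i : ℝ) + 1) / m - i / m = 1 / m := by ring
    linarith

/-- By monotonicity the brackets control every lower set up to `δ + 1 / m`; an interval is a
difference of two nested lower sets, whence the factor 2. The brackets depend on neither `ν` nor
`C`, so they can be fixed before sampling. -/
theorem exists_interval_brackets {E : Type*} [MeasurableSpace E] (μ : Measure E)
    [IsProbabilityMeasure μ] {f : E → ℝ} (hf : Measurable f) {m : ℕ} (hm : 0 < m) :
    ∃ F : Fin (m + 1) × Bool → Set E, (∀ a, MeasurableSet (F a)) ∧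
      ∀ (ν : Measure E) [IsFiniteMeasure ν] (C : Set E) (δ : ℝ), MeasurableSet C →
        (∀ a, |ν.real (C ∩ F a) - μ.real (C ∩ F a)| ≤ δ) → ∀ J : Set ℝ, J.OrdConnected →
        |ν.real (C ∩ f ⁻¹' J) - μ.real (C ∩ f ⁻¹' J)| ≤ 2 * (δ + 1 / m) := by
  have := Measure.isProbabilityMeasure_map (μ := μ) hf.aemeasurable
  obtain ⟨F, hFm, hF⟩ := exists_lowerSet_brackets (μ.map f) hm
  refine ⟨fun a => f ⁻¹' F a, fun a => hf (hFm a), fun ν _ C δ hC hdev J hJ => ?_⟩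
  have hlow : ∀ S, IsLowerSet S →
      |ν.real (C ∩ f ⁻¹' S) - μ.real (C ∩ f ⁻¹' S)| ≤ δ + 1 / m := by
    intro S hS
    obtain ⟨a, b, ha, hb, hab⟩ := hF S hS
    rw [map_measureReal_apply hf ((hFm b).diff (hFm a)), Set.preimage_sdiff] at hab
    have hsub : C ∩ f ⁻¹' F b ⊆ (C ∩ f ⁻¹' F a) ∪ (f ⁻¹' F b \ f ⁻¹' F a) := by
      rintro x ⟨hx, hx'⟩
      by_cases h : x ∈ f ⁻¹' F a
      · exact Or.inl ⟨hx, h⟩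
      · exact Or.inr ⟨hx', h⟩
    have h0 : μ.real (C ∩ f ⁻¹' F b) ≤ μ.real (C ∩ f ⁻¹' F a) + 1 / m :=
      (measureReal_mono hsub).trans ((measureReal_union_le _ _).trans (by gcongr))
    have ma : C ∩ f ⁻¹' F a ⊆ C ∩ f ⁻¹' S := Set.inter_subset_inter_right _ (Set.preimage_mono ha)
    have mb : C ∩ f ⁻¹' S ⊆ C ∩ f ⁻¹' F b := Set.inter_subset_inter_right _ (Set.preimage_mono hb)
    have h1 : μ.real (C ∩ f ⁻¹' F a) ≤ μ.real (C ∩ f ⁻¹' S) := measureReal_mono ma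
    have h2 : μ.real (C ∩ f ⁻¹' S) ≤ μ.real (C ∩ f ⁻¹' F b) := measureReal_mono mb
    have h3 : ν.real (C ∩ f ⁻¹' F a) ≤ ν.real (C ∩ f ⁻¹' S) := measureReal_mono ma
    have h4 : ν.real (C ∩ f ⁻¹' S) ≤ ν.real (C ∩ f ⁻¹' F b) := measureReal_mono mb
    have h5 := abs_le.1 (hdev a)
    have h6 := abs_le.1 (hdev b)
    rw [abs_le]
    constructor <;> linarith
  let L₁ : Set ℝ := lowerClosure J
  let L₂ : Set ℝ := lowerClosure J ∩ (upperClosure J : Set ℝ)ᶜ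
  have hL₁ : IsLowerSet L₁ := (lowerClosure J).lower
  have hL₂ : IsLowerSet L₂ := hL₁.inter (upperClosure J).upper.compl
  have hsub : L₂ ⊆ L₁ := Set.inter_subset_left
  have hJL : J = L₁ \ L₂ := by
    ext x
    have hx := Set.ext_iff.1 hJ.upperClosure_inter_lowerClosure x
    simp only [L₁, L₂, Set.mem_sdiff, Set.mem_inter_iff, Set.mem_compl_iff] at hx ⊢
    tauto
  have hsplit : ∀ (ρ : Measure E) [IsFiniteMeasure ρ],
      ρ.real (C ∩ f ⁻¹' J) = ρ.real (C ∩ f ⁻¹' L₁) - ρ.real (C ∩ f ⁻¹' L₂) := by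
    intro ρ _
    rw [← measureReal_sdiff (Set.inter_subset_inter_right _ (Set.preimage_mono hsub))
      (hC.inter (hf hL₂.ordConnected.measurableSet)), ← Set.inter_sdiff_distrib_left,
      ← Set.preimage_sdiff, ← hJL]
  rw [hsplit ν, hsplit μ]
  have h1 := abs_le.1 (hlow L₁ hL₁)
  have h2 := abs_le.1 (hlow L₂ hL₂)
  rw [abs_le]
  constructor <;> linarith

end Brackets

/-! ### Hoeffding's inequality, uniform over intervals. -/

section Deviation

variable {E Ω : Type*} [MeasurableSpace E] [MeasurableSpace Ω] {P : Measure Ω}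
  [IsProbabilityMeasure P] {μ : Measure E} {n : ℕ} {D : Fin n → Ω → E}

/-- A centred indicator is sub-Gaussian with variance proxy `1/4`; the factor 2 counts the two
tails. -/
theorem measure_abs_empMeasure_sub_ge_le (hlaw : ∀ i, HasLaw (D i) μ P) (hindep : iIndepFun D P)
    {A : Set E} (hA : MeasurableSet A) {δ : ℝ} (hδ : 0 ≤ δ) (hn : 0 < n) :
    P {ω | δ ≤ |(empMeasure fun i => D i ω).real A - μ.real A|} ≤
      ENNReal.ofReal (2 * Real.exp (-2 * n * δ ^ 2)) := by
  have hn0 : (0 : ℝ) < n := by exact_mod_cast hn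
  let g : E → ℝ := A.indicator 1
  have hg : Measurable g := measurable_one.indicator hA
  let X : Fin n → Ω → ℝ := fun i ω => g (D i ω) - μ.real A
  have hmean : ∀ i, P[fun ω => g (D i ω)] = μ.real A := fun i => by
    rw [← integral_indicator_one hA]
    exact (hlaw i).integral_comp hg.aestronglyMeasurable
  have hsub : ∀ i, HasSubgaussianMGF (X i) ((‖(1 : ℝ) - 0‖₊ / 2) ^ 2) P := fun i => by
    have := hasSubgaussianMGF_of_mem_Icc (μ := P) (X := fun ω => g (D i ω)) (a := 0) (b := 1)
      (hg.comp_aemeasurable (hlaw i).aemeasurable) (Eventually.of_forall fun ω => by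
        by_cases h : D i ω ∈ A <;> simp [g, h])
    rwa [hmean i] at this
  have hX : iIndepFun X P :=
    hindep.comp (fun _ x => g x - μ.real A) fun _ => hg.sub_const _
  have hX' : iIndepFun (fun i => -X i) P :=
    hindep.comp (fun _ x => -(g x - μ.real A)) fun _ => (hg.sub_const _).neg
  have hexp : -(n * δ) ^ 2 / (2 * ∑ i : Fin n, (((‖(1 : ℝ) - 0‖₊ / 2) ^ 2 : NNReal) : ℝ)) =
      -2 * n * δ ^ 2 := by
    simp
    field_simp
  have h1 := HasSubgaussianMGF.measure_sum_ge_le_of_iIndepFun hX (s := Finset.univ)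
    (fun i _ => hsub i) (ε := n * δ) (by positivity)
  have h2 := HasSubgaussianMGF.measure_sum_ge_le_of_iIndepFun hX' (s := Finset.univ)
    (fun i _ => (hsub i).neg) (ε := n * δ) (by positivity)
  rw [NNReal.coe_sum, hexp] at h1 h2
  have hcover : {ω | δ ≤ |(empMeasure fun i => D i ω).real A - μ.real A|} ⊆
      {ω | n * δ ≤ ∑ i, X i ω} ∪ {ω | n * δ ≤ ∑ i, (-X i) ω} := by
    intro ω hω
    have hsum : (n : ℝ) * ((empMeasure fun i => D i ω).real A - μ.real A) = ∑ i, X i ω := by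
      rw [empMeasure_real_apply _ hA]
      simp only [X, g, Finset.sum_sub_distrib, Finset.sum_const, Finset.card_univ,
        Fintype.card_fin, nsmul_eq_mul]
      field_simp
    rcases le_abs.1 (Set.mem_ofPred_eq ▸ hω) with h | h
    · left
      rw [Set.mem_ofPred_eq, ← hsum]
      gcongr
    · right
      simp only [Set.mem_ofPred_eq, Pi.neg_apply, Finset.sum_neg_distrib, ← hsum]
      nlinarith
  refine (measure_mono hcover).trans ((measure_union_le _ _).trans ?_)
  rw [two_mul, ENNReal.ofReal_add (Real.exp_nonneg _) (Real.exp_nonneg _)]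
  refine add_le_add ?_ ?_
  · rw [← ofReal_measureReal (by finiteness)]
    exact ENNReal.ofReal_le_ofReal h1
  · rw [← ofReal_measureReal (by finiteness)]
    exact ENNReal.ofReal_le_ofReal h2

theorem measure_exists_interval_deviation_le [IsProbabilityMeasure μ] (hlaw : ∀ i, HasLaw (D i) μ P)
    (hindep : iIndepFun D P) {f : E → ℝ} (hf : Measurable f) {ι : Type*} [Fintype ι]
    {C : ι → Set E} (hC : ∀ c, MeasurableSet (C c)) {m : ℕ} (hm : 0 < m) {δ : ℝ} (hδ : 0 ≤ δ)
    (hn : 0 < n) :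
    P {ω | ∃ c, ∃ J : Set ℝ, J.OrdConnected ∧ 2 * (δ + 1 / m) <
      |(empMeasure fun i => D i ω).real (C c ∩ f ⁻¹' J) - μ.real (C c ∩ f ⁻¹' J)|} ≤
      (Fintype.card ι * ((m + 1) * 2) : ℕ) * ENNReal.ofReal (2 * Real.exp (-2 * n * δ ^ 2)) := by
  obtain ⟨F, hFm, hF⟩ := exists_interval_brackets μ hf hm
  have hcover : {ω | ∃ c, ∃ J : Set ℝ, J.OrdConnected ∧ 2 * (δ + 1 / m) <
      |(empMeasure fun i => D i ω).real (C c ∩ f ⁻¹' J) - μ.real (C c ∩ f ⁻¹' J)|} ⊆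
      ⋃ x : ι × (Fin (m + 1) × Bool), {ω | δ ≤
        |(empMeasure fun i => D i ω).real (C x.1 ∩ F x.2) - μ.real (C x.1 ∩ F x.2)|} := by
    rintro ω ⟨c, J, hJ, hlt⟩
    by_contra hω
    simp only [Set.mem_iUnion, Set.mem_ofPred_eq, not_exists, not_le] at hω
    exact hlt.not_ge (hF _ (C c) δ (hC c) (fun a => (hω (c, a)).le) J hJ)
  refine (measure_mono hcover).trans ((measure_iUnion_fintype_le _ _).trans ?_)
  refine (Finset.sum_le_sum fun x _ => measure_abs_empMeasure_sub_ge_le hlaw hindep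
    ((hC x.1).inter (hFm x.2)) hδ hn).trans ?_
  simp

end Deviation

/-! ### Approximating arbitrary grids by range grids. -/

section Approximation

theorem mem_nhds_of_ordConnected {S : Set ℝ} (hS : S.OrdConnected) {x : ℝ} (hx : x ∈ S)
    (hInf : x ≠ sInf S) (hSup : x ≠ sSup S) : S ∈ 𝓝 x := by
  have h1 : ∃ y ∈ S, y < x := by
    by_contra! h
    exact hInf (IsLeast.csInf_eq ⟨hx, h⟩).symm
  have h2 : ∃ z ∈ S, x < z := by
    by_contra! h
    exact hSup (IsGreatest.csSup_eq ⟨hx, h⟩).symm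
  obtain ⟨y, hy, hyx⟩ := h1
  obtain ⟨z, hz, hxz⟩ := h2
  exact mem_of_superset (Icc_mem_nhds hyx hxz) (hS.out hy hz)

theorem abs_sub_le_of_mem_rangeEquipartition {a b : ℝ} {M : ℕ} {e : Fin M} {s t : ℝ}
    (hs : s ∈ rangeEquipartition a b M e) (ht : t ∈ rangeEquipartition a b M e) :
    |s - t| ≤ (b - a) / M := by
  have hM : (M : ℝ) ≠ 0 := by
    have := e.pos
    positivity
  have key : ∀ u ∈ rangeEquipartition a b M e, u ≤ a + ((e : ℝ) + 1) * ((b - a) / M) := by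
    rintro u ⟨-, h | ⟨h, rfl⟩⟩
    · exact h.le
    · have : ((e : ℝ) + 1) = M := by exact_mod_cast h
      rw [this]
      field_simp
      linarith
  have h1 := key s hs
  have h2 := key t ht
  have h3 := hs.1
  have h4 := ht.1
  rw [abs_le]
  constructor <;> linarith

/-- Merging the parts of a fine range equipartition approximates every interval partition,
pointwise on the range. -/
theorem exists_labels_rangeEquipartition {a b : ℝ} (hab : a < b) {ℓ : ℕ} {Q : Fin ℓ → Set ℝ}
    (hQ : IsIntervalPartition Set.univ Q) :
    ∃ c : ∀ M, Fin M → Fin ℓ, ∀ j, ∀ x ∈ Set.Icc a b, ∀ᶠ M in atTop,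
      ((∃ e : Fin M, c M e = j ∧ x ∈ rangeEquipartition a b M e) ↔ x ∈ Q j) := by
  have hcov : ∀ x, ∃ j, x ∈ Q j := fun x => by
    have : x ∈ ⋃ j, Q j := by rw [hQ.cover]; trivial
    simpa using this
  choose f hf using hcov
  have hfQ : ∀ {x j}, x ∈ Q j → f x = j := fun {x j} h => by
    by_contra hne
    exact Set.disjoint_left.1 (hQ.disjoint hne) (hf x) h
  -- The endpoints of the parts; the default value of `sInf` or `sSup` on an unbounded part only
  -- adds a harmless point.
  let T : Set ℝ := ⋃ j, {sInf (Q j), sSup (Q j)}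
  have hT : T.Finite := Set.finite_iUnion fun j => Set.toFinite _
  -- Each cell gets the label of a representative, chosen in `T` whenever the cell meets `T`. For a
  -- fine mesh, the cell of `x ∈ T` has `x` as representative, while around `x ∉ T` the labelling
  -- `f` is constant. Endpoints are thus labelled correctly, so atoms there cause no error.
  have hrep : ∀ M (e : Fin M), ∃ t ∈ rangeEquipartition a b M e,
      (∃ s ∈ T, s ∈ rangeEquipartition a b M e) → t ∈ T := by
    intro M e
    by_cases h : ∃ s ∈ T, s ∈ rangeEquipartition a b M e
    · obtain ⟨s, hs, hse⟩ := h
      exact ⟨s, hse, fun _ => hs⟩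
    · obtain ⟨t, ht⟩ := (isIntervalPartition_rangeEquipartition hab e.pos).nonempty e
      exact ⟨t, ht, fun h' => absurd h' h⟩
  choose rep hrepmem hrepT using hrep
  refine ⟨fun M e => f (rep M e), fun j x hx => ?_⟩
  have hnhds : ∀ᶠ y in 𝓝 x, (y ∈ T → y = x) ∧ (x ∉ T → f y = f x) := by
    refine Eventually.and ?_ ?_
    · have : (T \ {x})ᶜ ∈ 𝓝 x := (hT.subset Set.sdiff_subset).isClosed.isOpen_compl.mem_nhds
        (by simp)
      filter_upwards [this] with y hy hyT
      by_contra hne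
      exact hy ⟨hyT, hne⟩
    · by_cases hxT : x ∈ T
      · exact Eventually.of_forall fun y h => absurd hxT h
      · have : Q (f x) ∈ 𝓝 x := mem_nhds_of_ordConnected (hQ.interval _) (hf x)
          (fun h => hxT (Set.mem_iUnion.2 ⟨f x, Or.inl h⟩))
          (fun h => hxT (Set.mem_iUnion.2 ⟨f x, Or.inr h⟩))
        filter_upwards [this] with y hy _
        exact hfQ hy
  obtain ⟨r, hr, hball⟩ := Metric.eventually_nhds_iff.1 hnhds
  have hlim : Tendsto (fun M : ℕ => (b - a) / M) atTop (𝓝 0) :=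
    tendsto_const_div_atTop_nhds_zero_nat _
  filter_upwards [hlim.eventually (gt_mem_nhds hr), eventually_ge_atTop 1] with M hM hM1
  have hpart := isIntervalPartition_rangeEquipartition hab hM1
  obtain ⟨e₀, he₀⟩ : ∃ e, x ∈ rangeEquipartition a b M e := by
    rw [← hpart.cover] at hx
    simpa using hx
  have hclose : dist (rep M e₀) x < r :=
    (abs_sub_le_of_mem_rangeEquipartition (hrepmem M e₀) he₀).trans_lt hM
  have hlabel : f (rep M e₀) = f x := by
    by_cases hxT : x ∈ T
    · rw [(hball hclose).1 (hrepT M e₀ ⟨x, hxT, he₀⟩)]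
    · exact (hball hclose).2 hxT
  constructor
  · rintro ⟨e, he, hxe⟩
    have : e = e₀ := by
      by_contra hne
      exact Set.disjoint_left.1 (hpart.disjoint hne) hxe he₀
    rw [← he, this, hlabel]
    exact hf x
  · intro hxj
    exact ⟨e₀, hlabel.trans (hfQ hxj), he₀⟩

/-- The merged cells converge pointwise on `L`, so their masses converge and, by continuity, so does
the mutual information of the merged matrix. Merging only loses information, so the unmerged grid
does at least as well. -/
theorem eventually_sub_lt_mutualInfo_rangeEquipartition {L : PlaneRange} {μ : Measure (ℝ × ℝ)}
    [IsFiniteMeasure μ] (hμ : ∀ᵐ z ∂μ, z ∈ L.toSet) {k ℓ : ℕ} {R : Fin k → Set ℝ}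
    (hR : ∀ i, MeasurableSet (R i)) {Q : Fin ℓ → Set ℝ} (hQ : IsIntervalPartition Set.univ Q)
    {ε : ℝ} (hε : 0 < ε) :
    ∀ᶠ M : ℕ in atTop, mutualInfo (distMatrix μ ((R, Q) : Grid k ℓ)) - ε <
      mutualInfo (distMatrix μ ((R, rangeEquipartition L.x₀ L.x₁ M) : Grid k M)) := by
  obtain ⟨c, hc⟩ := exists_labels_rangeEquipartition L.hx hQ
  have hmeas : ∀ M (e : Fin M), MeasurableSet (rangeEquipartition L.x₀ L.x₁ M e) := fun M e =>
    (isIntervalPartition_rangeEquipartition L.hx e.pos).measurableSet e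
  have hmeas' : ∀ M j i, MeasurableSet
      (⋃ e ∈ Finset.univ.filter fun e => c M e = j, rangeEquipartition L.x₀ L.x₁ M e ×ˢ R i) :=
    fun M j i => Finset.measurableSet_biUnion _ fun e _ => (hmeas M e).prod (hR i)
  have hsum : ∀ M i j, ∑ e with c M e = j,
      distMatrix μ ((R, rangeEquipartition L.x₀ L.x₁ M) : Grid k M) i e =
      μ.real (⋃ e ∈ Finset.univ.filter fun e => c M e = j,
        rangeEquipartition L.x₀ L.x₁ M e ×ˢ R i) := by
    intro M i j
    rw [measureReal_biUnion_finset]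
    · rfl
    · intro e _ e' _ hee
      exact Set.disjoint_prod.2
        (Or.inl ((isIntervalPartition_rangeEquipartition L.hx e.pos).disjoint hee))
    · exact fun e _ => (hmeas M e).prod (hR i)
  have hlim : Tendsto (fun M => mutualInfo fun i j => ∑ e with c M e = j,
      distMatrix μ ((R, rangeEquipartition L.x₀ L.x₁ M) : Grid k M) i e) atTop
      (𝓝 (mutualInfo (distMatrix μ ((R, Q) : Grid k ℓ)))) := by
    refine tendsto_mutualInfo (fun M i j => Finset.sum_nonneg fun e _ => distMatrix_nonneg _ _ _ _)
      (distMatrix_nonneg _ _) fun i j => ?_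
    simp only [hsum]
    refine (ENNReal.tendsto_toReal (by finiteness)).comp
      (tendsto_measure_of_ae_tendsto_indicator_of_isFiniteMeasure atTop
        ((hQ.measurableSet j).prod (hR i)) (fun M => hmeas' M j i) ?_)
    filter_upwards [hμ] with z hz
    filter_upwards [hc j z.1 hz.1] with M hM
    change _ ↔ z.1 ∈ Q j ∧ z.2 ∈ R i
    rw [← hM]
    simp only [Set.mem_iUnion, Finset.mem_filter, Finset.mem_univ, true_and, Set.mem_prod,
      exists_prop]
    tauto
  filter_upwards [hlim.eventually (lt_mem_nhds (sub_lt_self _ hε))] with M hM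
  exact hM.trans_le (mutualInfo_merge_le _ (distMatrix_nonneg _ _) (c M))

theorem IsIntervalPartition.exists_restrict {k : ℕ} {R : Fin k → Set ℝ}
    (hR : IsIntervalPartition Set.univ R) {S : Set ℝ} (hS : S.OrdConnected) :
    ∃ (k' : ℕ) (e : Fin k' → Fin k), Function.Injective e ∧
      IsIntervalPartition S (fun i => R (e i) ∩ S) ∧ ∀ i ∉ Set.range e, R i ∩ S = ∅ := by
  classical
  let e := (Fintype.equivFin {i // (R i ∩ S).Nonempty}).symm
  refine ⟨_, fun i => (e i).1, Subtype.val_injective.comp e.injective,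
    ⟨fun i => (e i).2, fun i => (hR.interval _).inter hS, fun i j hij => ?_, ?_⟩, fun i hi => ?_⟩
  · exact (hR.disjoint fun h => hij (e.injective (Subtype.ext h))).mono
      Set.inter_subset_left Set.inter_subset_left
  · ext x
    simp only [Set.mem_iUnion, Set.mem_inter_iff]
    refine ⟨fun ⟨_, h⟩ => h.2, fun hx => ?_⟩
    have : x ∈ ⋃ i, R i := by rw [hR.cover]; trivial
    obtain ⟨i, hi⟩ := Set.mem_iUnion.1 this
    exact ⟨e.symm ⟨i, x, hi, hx⟩, by simpa using hi, hx⟩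
  · by_contra h
    exact hi ⟨e.symm ⟨i, Set.nonempty_iff_ne_empty.2 h⟩, by simp⟩

/-- Rows missing `[y₀, y₁]` carry no mass and are dropped. The normalizer becomes `log k'` with `k'
≤ k`, which can only help. Strictness of `k' < M` is what the transposed case of `rangeGrids`
demands. -/
theorem exists_row_rangeGrid_approx {L : PlaneRange} {μ : Measure (ℝ × ℝ)}
    [IsProbabilityMeasure μ] (hμ : ∀ᵐ z ∂μ, z ∈ L.toSet) {k ℓ : ℕ} (hkℓ : k ≤ ℓ)
    {G : Grid k ℓ} (hG : G ∈ allGrids k ℓ) {ε : ℝ} (hε : 0 < ε) :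
    ∃ k' M : ℕ, 2 ≤ k' ∧ k' < M ∧ ∃ R : Fin k' → Set ℝ,
      IsIntervalPartition (Set.Icc L.y₀ L.y₁) R ∧ normMutualInfo (distMatrix μ G) - ε <
        normMutualInfo (distMatrix μ ((R, rangeEquipartition L.x₀ L.x₁ M) : Grid k' M)) := by
  obtain ⟨k', e, he, hR, hemp⟩ := hG.1.exists_restrict (S := Set.Icc L.y₀ L.y₁) Set.ordConnected_Icc
  set R : Fin k' → Set ℝ := fun i => G.1 (e i) ∩ Set.Icc L.y₀ L.y₁ with hRdef
  have hrows : distMatrix μ ((R, G.2) : Grid k' ℓ) = fun i => distMatrix μ G (e i) := by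
    ext i j
    refine measureReal_congr ?_
    filter_upwards [hμ] with z hz
    exact propext (and_congr Iff.rfl ⟨fun h => h.1, fun h => ⟨h, hz.2⟩⟩)
  have hMI : mutualInfo (distMatrix μ ((R, G.2) : Grid k' ℓ)) = mutualInfo (distMatrix μ G) := by
    rw [hrows]
    refine mutualInfo_comp_rows he fun i hi j => ?_
    rw [distMatrix, measureReal_def, ENNReal.toReal_eq_zero_iff]
    left
    refine measure_eq_zero_iff_ae_notMem.2 ?_
    filter_upwards [hμ] with z hz hzc
    have : z.2 ∈ G.1 i ∩ Set.Icc L.y₀ L.y₁ := ⟨hzc.2, hz.2⟩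
    rw [hemp i hi] at this
    exact this
  have hkle : k' ≤ k := by simpa using Fintype.card_le_of_injective e he
  -- With fewer than two surviving rows the information is zero, and any admissible grid will do.
  rcases lt_or_ge k' 2 with hk2 | hk2
  · have hzero : mutualInfo (distMatrix μ G) = 0 := by
      rw [← hMI]
      interval_cases k'
      · simp [mutualInfo]
      · have hrow := sum_distMatrix_row (G := ((R, G.2) : Grid 1 ℓ)) (ν := μ) hR hG.2 0
        have h1 : μ.real (Set.univ ×ˢ R 0) = 1 := by
          have : R 0 = Set.Icc L.y₀ L.y₁ := by
            rw [← hR.cover]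
            ext x
            simp
          rw [this, ← probReal_univ (μ := μ)]
          refine measureReal_congr ?_
          filter_upwards [hμ] with z hz
          exact propext ⟨fun _ => trivial, fun _ => ⟨trivial, hz.2⟩⟩
        rw [mutualInfo_eq_negMulLog (distMatrix_nonneg _ _)]
        simp only [Fin.sum_univ_one, Fin.isValue]
        change ∑ j, distMatrix μ ((R, G.2) : Grid 1 ℓ) 0 j = μ.real (Set.univ ×ˢ R 0) at hrow
        rw [hrow, h1]
        simp
    have hp2 := isIntervalPartition_rangeEquipartition L.hy (ℓ := 2) (by norm_num)
    have hp3 := isIntervalPartition_rangeEquipartition L.hx (ℓ := 3) (by norm_num)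
    refine ⟨2, 3, le_rfl, by norm_num, rangeEquipartition L.y₀ L.y₁ 2, hp2, ?_⟩
    have h0 : normMutualInfo (distMatrix μ G) = 0 := by rw [normMutualInfo, hzero, zero_div]
    have := normMutualInfo_nonneg (distMatrix_nonneg μ
      ((rangeEquipartition L.y₀ L.y₁ 2, rangeEquipartition L.x₀ L.x₁ 3) : Grid 2 3))
      (sum_distMatrix_le_one (by simp) hp2 hp3)
    linarith
  · obtain ⟨M, hM, hkM⟩ := ((eventually_sub_lt_mutualInfo_rangeEquipartition hμ hR.measurableSet
      hG.2 hε).and (eventually_gt_atTop k')).exists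
    refine ⟨k', M, hk2, hkM, R, hR, ?_⟩
    rw [hMI] at hM
    have hlog := one_le_logb_min hk2 hk2
    rw [min_self] at hlog
    have hlog2 : Real.logb 2 (k' : ℝ) ≤ Real.logb 2 (k : ℝ) :=
      Real.logb_le_logb_of_le (by norm_num) (by positivity) (by exact_mod_cast hkle)
    have hI0 : 0 ≤ mutualInfo (distMatrix μ G) := mutualInfo_nonneg (distMatrix_nonneg _ _)
      (sum_distMatrix_le_one (by simp) hG.1 hG.2)
    rw [normMutualInfo, normMutualInfo, min_eq_left hkℓ, min_eq_left hkM.le]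
    calc _ ≤ mutualInfo (distMatrix μ G) / Real.logb 2 (k' : ℝ) - ε := by gcongr
      _ ≤ mutualInfo (distMatrix μ G) / Real.logb 2 (k' : ℝ) - ε / Real.logb 2 (k' : ℝ) := by
        gcongr
        exact div_le_self hε.le hlog
      _ = (mutualInfo (distMatrix μ G) - ε) / Real.logb 2 (k' : ℝ) := (sub_div _ _ _).symm
      _ < _ := by gcongr

theorem distMatrix_map_swap (μ : Measure (ℝ × ℝ)) {k ℓ : ℕ} (G : Grid k ℓ) :
    distMatrix (μ.map Prod.swap) ((G.2, G.1) : Grid ℓ k) = fun j i => distMatrix μ G i j := by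
  ext j i
  rw [distMatrix, distMatrix, measureReal_def, measureReal_def]
  change ((μ.map MeasurableEquiv.prodComm) _).toReal = _
  rw [MeasurableEquiv.map_apply]
  congr 2
  ext z
  exact and_comm

theorem exists_rangeGrid_approx {L : PlaneRange} {μ : Measure (ℝ × ℝ)}
    [IsProbabilityMeasure μ] (hμ : ∀ᵐ z ∂μ, z ∈ L.toSet) {k ℓ : ℕ} {G : Grid k ℓ}
    (hG : G ∈ allGrids k ℓ) {ε : ℝ} (hε : 0 < ε) :
    ∃ k' ℓ' : ℕ, 2 ≤ k' ∧ 2 ≤ ℓ' ∧ ∃ G' ∈ rangeGrids L k' ℓ',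
      normMutualInfo (distMatrix μ G) - ε < normMutualInfo (distMatrix μ G') := by
  rcases le_total k ℓ with h | h
  · obtain ⟨k', M, hk', hM, R, hR, hlt⟩ := exists_row_rangeGrid_approx hμ h hG hε
    exact ⟨k', M, hk', by omega, (R, _), Or.inl ⟨hM.le, rfl, hR⟩, hlt⟩
  · let L' : PlaneRange := ⟨L.y₀, L.y₁, L.x₀, L.x₁, L.hy, L.hx⟩
    have := Measure.isProbabilityMeasure_map (μ := μ) measurable_swap.aemeasurable
    have hμ' : ∀ᵐ z ∂(μ.map Prod.swap), z ∈ L'.toSet := by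
      have hL' : MeasurableSet {z | z ∈ L'.toSet} := measurableSet_Icc.prod measurableSet_Icc
      rw [ae_map_iff measurable_swap.aemeasurable hL']
      filter_upwards [hμ] with z hz
      exact ⟨hz.2, hz.1⟩
    obtain ⟨ℓ', M, hℓ', hM, R, hR, hlt⟩ := exists_row_rangeGrid_approx hμ' h
      (G := ((G.2, G.1) : Grid ℓ k)) ⟨hG.2, hG.1⟩ hε
    refine ⟨M, ℓ', by omega, hℓ', (rangeEquipartition L.y₀ L.y₁ M, R), Or.inr ⟨hM, rfl, hR⟩, ?_⟩
    rw [distMatrix_map_swap] at hlt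
    have h2 := distMatrix_map_swap μ ((rangeEquipartition L.y₀ L.y₁ M, R) : Grid M ℓ')
    change distMatrix _ ((R, rangeEquipartition L'.x₀ L'.x₁ M) : Grid ℓ' M) = _ at h2
    rwa [h2, normMutualInfo_transpose (distMatrix μ G), normMutualInfo_transpose
      (distMatrix μ ((rangeEquipartition L.y₀ L.y₁ M, R) : Grid M ℓ'))] at hlt

end Approximation

/-! ### Uniform deviation over range grids and asymptotic rates. -/

section Consistency

theorem rangeEquipartition_one {a b : ℝ} (hab : a < b) :
    rangeEquipartition a b 1 0 = Set.Icc a b := by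
  rw [← (isIntervalPartition_rangeEquipartition hab le_rfl).cover]
  ext x
  simp

theorem abs_normMutualInfo_sub_le_of_mem_rangeGrids {L : PlaneRange} {ν μ : Measure (ℝ × ℝ)}
    [IsFiniteMeasure ν] [IsFiniteMeasure μ] (hν : ν.real Set.univ ≤ 1) (hμ : μ.real Set.univ ≤ 1)
    {n : ℕ} {δ γ : ℝ} (hγ : 0 < γ) (hγ1 : γ < 1) (hδ : 0 ≤ δ)
    (hx : ∀ ℓ ≤ n, ∀ j : Fin ℓ, ∀ J : Set ℝ, J.OrdConnected →
      |ν.real (rangeEquipartition L.x₀ L.x₁ ℓ j ×ˢ J) -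
        μ.real (rangeEquipartition L.x₀ L.x₁ ℓ j ×ˢ J)| ≤ δ)
    (hy : ∀ k ≤ n, ∀ i : Fin k, ∀ J : Set ℝ, J.OrdConnected →
      |ν.real (J ×ˢ rangeEquipartition L.y₀ L.y₁ k i) -
        μ.real (J ×ˢ rangeEquipartition L.y₀ L.y₁ k i)| ≤ δ)
    {k ℓ : ℕ} (hk : 2 ≤ k) (hℓ : 2 ≤ ℓ) (hkn : k ≤ n) (hℓn : ℓ ≤ n) {G : Grid k ℓ}
    (hG : G ∈ rangeGrids L k ℓ) :
    |normMutualInfo (distMatrix ν G) - normMutualInfo (distMatrix μ G)| ≤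
      3 * (k * ℓ) * (δ ^ (1 - γ) / γ) / Real.log 2 := by
  obtain ⟨h1, h2⟩ := isIntervalPartition_of_mem_rangeGrids (by omega) (by omega) hG
  refine abs_normMutualInfo_distMatrix_sub_le hγ hγ1 hk hℓ hδ hν hμ h1 h2 ?_ ?_ ?_
  · rcases hG with ⟨-, h, -⟩ | ⟨-, h, -⟩
    · exact fun i j => h ▸ hx ℓ hℓn j _ (h1.interval i)
    · exact fun i j => h ▸ hy k hkn i _ (h2.interval j)
  -- When the columns are the equipartition, a row marginal is a strip over the whole `x`-range,
  -- which is the equipartition of size one and so is covered by `hx`.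
  · rcases hG with - | ⟨-, h, -⟩
    · intro i
      rw [← rangeEquipartition_one L.hx]
      exact hx 1 (by omega) 0 _ (h1.interval i)
    · exact fun i => h ▸ hy k hkn i _ Set.ordConnected_Icc
  · rcases hG with ⟨-, h, -⟩ | -
    · exact fun j => h ▸ hx ℓ hℓn j _ Set.ordConnected_Icc
    · intro j
      rw [← rangeEquipartition_one L.hy]
      exact hy 1 (by omega) 0 _ (h2.interval j)

theorem measure_exists_rangeGrid_deviation_le {Ω : Type*} [MeasurableSpace Ω] {P : Measure Ω}
    [IsProbabilityMeasure P] {μ : Measure (ℝ × ℝ)} [IsProbabilityMeasure μ] {n : ℕ}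
    {D : Fin n → Ω → ℝ × ℝ} (hlaw : ∀ i, HasLaw (D i) μ P) (hindep : iIndepFun D P)
    (L : PlaneRange) (hn : 0 < n) {δ γ : ℝ} (hδ : 0 ≤ δ) (hγ : 0 < γ) (hγ1 : γ < 1) :
    P {ω | ∃ k ℓ : ℕ, 2 ≤ k ∧ 2 ≤ ℓ ∧ k ≤ n ∧ ℓ ≤ n ∧ ∃ G ∈ rangeGrids L k ℓ,
      3 * (k * ℓ) * ((2 * (δ + 1 / n)) ^ (1 - γ) / γ) / Real.log 2 <
        |normMutualInfo (sampleMatrix (fun i => D i ω) G) - normMutualInfo (distMatrix μ G)|} ≤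
      ENNReal.ofReal (8 * (n + 1) ^ 3 * Real.exp (-2 * n * δ ^ 2)) := by
  -- All parts of all equipartitions of size at most `n`: at most `(n + 1) ^ 2` strips per axis.
  -- Each meets `2 (n + 1)` brackets (`m = n`), each at cost `2 exp (-2 n δ ^ 2)`; two axes give the
  -- constant 8.
  let ι := Σ ℓ : Fin (n + 1), Fin ℓ
  have hcard : Fintype.card ι ≤ (n + 1) * (n + 1) := by
    rw [Fintype.card_sigma]
    refine (Finset.sum_le_sum fun ℓ _ => ?_).trans_eq (b := ∑ _ : Fin (n + 1), (n + 1)) (by simp)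
    rw [Fintype.card_fin]
    exact ℓ.2.le
  have hmeas : ∀ {a b : ℝ}, a < b → ∀ c : ι, MeasurableSet (rangeEquipartition a b c.1 c.2) :=
    fun hab c => (isIntervalPartition_rangeEquipartition hab c.2.pos).measurableSet c.2
  have bdx := measure_exists_interval_deviation_le hlaw hindep measurable_snd
    (C := fun c : ι => Prod.fst ⁻¹' rangeEquipartition L.x₀ L.x₁ c.1 c.2)
    (fun c => measurable_fst (hmeas L.hx c)) hn hδ hn
  have bdy := measure_exists_interval_deviation_le hlaw hindep measurable_fst
    (C := fun c : ι => Prod.snd ⁻¹' rangeEquipartition L.y₀ L.y₁ c.1 c.2)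
    (fun c => measurable_snd (hmeas L.hy c)) hn hδ hn
  have hbound : ((Fintype.card ι * ((n + 1) * 2) : ℕ) : ENNReal) *
      ENNReal.ofReal (2 * Real.exp (-2 * n * δ ^ 2)) ≤
      ENNReal.ofReal (4 * (n + 1) ^ 3 * Real.exp (-2 * n * δ ^ 2)) := by
    rw [← ENNReal.ofReal_natCast, ← ENNReal.ofReal_mul (by positivity)]
    refine ENNReal.ofReal_le_ofReal ?_
    have : ((Fintype.card ι * ((n + 1) * 2) : ℕ) : ℝ) ≤ 2 * (n + 1) ^ 3 := by
      have h := Nat.mul_le_mul_right ((n + 1) * 2) hcard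
      calc ((Fintype.card ι * ((n + 1) * 2) : ℕ) : ℝ)
          ≤ (((n + 1) * (n + 1) * ((n + 1) * 2) : ℕ) : ℝ) := by exact_mod_cast h
        _ = 2 * (n + 1) ^ 3 := by push_cast; ring
    calc _ ≤ 2 * ((n : ℝ) + 1) ^ 3 * (2 * Real.exp (-2 * n * δ ^ 2)) := by gcongr
      _ = _ := by ring
  have hsplit : (8 : ℝ) * (n + 1) ^ 3 * Real.exp (-2 * n * δ ^ 2) =
      4 * (n + 1) ^ 3 * Real.exp (-2 * n * δ ^ 2) + 4 * (n + 1) ^ 3 * Real.exp (-2 * n * δ ^ 2) := by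
    ring
  rw [hsplit, ENNReal.ofReal_add (by positivity) (by positivity)]
  refine le_trans (measure_mono ?_) ((measure_union_le _ _).trans
    (add_le_add (bdx.trans hbound) (bdy.trans hbound)))
  rintro ω ⟨k, ℓ, hk, hℓ, hkn, hℓn, G, hG, hlt⟩
  by_contra hω
  rw [Set.mem_union, not_or] at hω
  obtain ⟨hωx, hωy⟩ := hω
  simp only [Set.mem_ofPred_eq, not_exists, not_and, not_lt] at hωx hωy
  obtain ⟨h1, h2⟩ := isIntervalPartition_of_mem_rangeGrids (by omega) (by omega) hG
  rw [sampleMatrix_eq_distMatrix _ h1 h2] at hlt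
  refine hlt.not_ge (abs_normMutualInfo_sub_le_of_mem_rangeGrids (empMeasure_real_univ_le _)
    (by simp) hγ hγ1 (by positivity) (fun ℓ' hℓ' j J hJ => ?_) (fun k' hk' i J hJ => ?_)
    hk hℓ hkn hℓn hG)
  · exact hωx ⟨⟨ℓ', by omega⟩, j⟩ J hJ
  · have := hωy ⟨⟨k', by omega⟩, i⟩ J hJ
    rw [Set.inter_comm] at this
    exact this

theorem tendsto_pow_mul_exp_neg_rpow {β : ℝ} (hβ : β < 1 / 2) :
    Tendsto (fun n : ℕ => 8 * ((n : ℝ) + 1) ^ 3 * Real.exp (-2 * n * ((n : ℝ) ^ (-β)) ^ 2))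
      atTop (𝓝 0) := by
  have hs : 0 < 1 - 2 * β := by linarith
  -- In the variable `s = n ^ (1 - 2 * β)` the bound is a power of `s` times `exp (-2 s)`; `64`
  -- comes from `8 (n + 1) ^ 3 ≤ 8 (2 n) ^ 3`.
  have h1 := (tendsto_rpow_mul_exp_neg_mul_atTop_nhds_zero (3 / (1 - 2 * β)) 2 two_pos).comp
    ((tendsto_rpow_atTop hs).comp tendsto_natCast_atTop_atTop)
  have h2 := h1.const_mul 64
  rw [mul_zero] at h2
  refine squeeze_zero' (Eventually.of_forall fun n => by positivity) ?_ h2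
  filter_upwards [eventually_ge_atTop 1] with n hn
  have hn1 : (1 : ℝ) ≤ n := by exact_mod_cast hn
  have hn0 : (0 : ℝ) < n := by linarith
  have he : (n : ℝ) * ((n : ℝ) ^ (-β)) ^ 2 = (n : ℝ) ^ (1 - 2 * β) := by
    rw [← Real.rpow_natCast, ← Real.rpow_mul hn0.le, ← Real.rpow_one_add' hn0.le]
    · congr 1
      push_cast
      ring
    · push_cast
      linarith
  have hp : ((n : ℝ) ^ (1 - 2 * β)) ^ (3 / (1 - 2 * β)) = (n : ℝ) ^ 3 := by
    rw [← Real.rpow_mul hn0.le, mul_div_cancel₀ _ hs.ne']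
    norm_cast
  simp only [Function.comp_apply, hp]
  rw [mul_assoc (-2), he]
  have : ((n : ℝ) + 1) ^ 3 ≤ (2 * n) ^ 3 := by
    gcongr
    linarith
  calc _ ≤ 8 * (2 * (n : ℝ)) ^ 3 * Real.exp (-2 * (n : ℝ) ^ (1 - 2 * β)) := by gcongr
    _ = _ := by ring

theorem tendsto_mul_rpow_of_isBigO {B : ℕ → ℝ} {α β γ c : ℝ} (hc : 0 ≤ c)
    (hB : B =O[atTop] fun n : ℕ => (n : ℝ) ^ α) (h : α < β * (1 - γ)) :
    Tendsto (fun n : ℕ => B n * (c * (n : ℝ) ^ (-β)) ^ (1 - γ)) atTop (𝓝 0) := by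
  have h1 : (fun n : ℕ => B n * (c * (n : ℝ) ^ (-β)) ^ (1 - γ)) =O[atTop]
      fun n : ℕ => (n : ℝ) ^ (-(β * (1 - γ) - α)) := by
    have h2 : (fun n : ℕ => (c * (n : ℝ) ^ (-β)) ^ (1 - γ)) =O[atTop]
        fun n : ℕ => (n : ℝ) ^ (-(β * (1 - γ))) := by
      refine (Asymptotics.isBigO_refl _ atTop).const_mul_left (c ^ (1 - γ)) |>.congr_left
        fun n => ?_
      rw [Real.mul_rpow hc (by positivity), ← Real.rpow_mul (by positivity), neg_mul]
    refine (hB.mul h2).congr' EventuallyEq.rfl ?_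
    filter_upwards [eventually_ge_atTop 1] with n hn
    have hn0 : (0 : ℝ) < n := by exact_mod_cast hn
    rw [← Real.rpow_add hn0]
    congr 1
    ring
  exact h1.trans_tendsto ((tendsto_rpow_neg_atTop (by linarith)).comp
    tendsto_natCast_atTop_atTop)

theorem eventually_le_natCast_of_isBigO {B : ℕ → ℝ} {α : ℝ} (hα : α < 1)
    (hB : B =O[atTop] fun n : ℕ => (n : ℝ) ^ α) : ∀ᶠ n : ℕ in atTop, B n ≤ n := by
  have h := tendsto_mul_rpow_of_isBigO (β := 1) (γ := 0) (c := 1) zero_le_one hB (by linarith)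
  filter_upwards [h.eventually (gt_mem_nhds one_pos), eventually_ge_atTop 1] with n hn hn1
  have hn0 : (0 : ℝ) < n := by exact_mod_cast hn1
  rw [one_mul, sub_zero, Real.rpow_one, Real.rpow_neg_one, ← div_eq_mul_inv, div_lt_one hn0] at hn
  exact hn.le

end Consistency

end MICr


/-! ### The convergence theorem. -/

theorem mainTheorem3
    (L : MICr.PlaneRange)
    (μ : Measure (ℝ × ℝ)) [IsProbabilityMeasure μ]
    (hμ : ∀ᵐ z ∂μ, z ∈ L.toSet)
    {Ω : ℕ → Type*} [∀ n, MeasurableSpace (Ω n)]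
    (P : ∀ n, Measure (Ω n)) [∀ n, IsProbabilityMeasure (P n)]
    (D : ∀ n, Fin n → Ω n → ℝ × ℝ)
    (hlaw : ∀ n i, HasLaw (D n i) μ (P n))
    (hindep : ∀ n, iIndepFun (D n) (P n))
    (α : ℝ) (hα₀ : 0 < α) (hα : α < 1 / 2)
    (B : ℕ → ℝ)
    (hBtop : Tendsto B atTop atTop)
    (hBO : B =O[atTop] fun n : ℕ => (n : ℝ) ^ α) :
    ∀ ε : ℝ, 0 < ε →
      Tendsto
        (fun n => P n {ω | ε ≤ |MICr.micrUnconstrained (fun i => D n i ω) L (B n)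
          - MICr.micStar μ|})
        atTop (𝓝 0) := by
  intro ε hε
  -- `β` is the midpoint of `α` and `1/2`. With this `γ`, `β * (1 - γ) = (1 + 2 * α) ^ 2 / 8`, which
  -- exceeds `α` because `(1 - 2 * α) ^ 2 > 0`.
  obtain ⟨β, hβ⟩ : ∃ β, β = (2 * α + 1) / 4 := ⟨_, rfl⟩
  obtain ⟨γ, hγ⟩ : ∃ γ, γ = (1 - 2 * α) / 2 := ⟨_, rfl⟩
  have hγ0 : 0 < γ := by linarith
  have hγ1 : γ < 1 := by linarith
  have hβγ : α < β * (1 - γ) := by rw [hβ, hγ]; nlinarith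
  have hlog : 0 < Real.log 2 := Real.log_pos (by norm_num)
  have herr : Tendsto (fun n : ℕ => B n * (4 * (n : ℝ) ^ (-β)) ^ (1 - γ) *
      (3 / γ / Real.log 2)) atTop (𝓝 0) := by
    simpa using (MICr.tendsto_mul_rpow_of_isBigO (by norm_num) hBO hβγ).mul_const
      (3 / γ / Real.log 2)
  -- The lower bound spends `ε / 3` three times: on a nearly optimal grid, on its range-grid
  -- approximation, and on sampling.
  obtain ⟨k₀, ℓ₀, hk₀, hℓ₀, G₀, hG₀, hlt₀⟩ := MICr.exists_micStar_sub_lt μ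
    (show 0 < ε / 3 by linarith)
  obtain ⟨k₁, ℓ₁, hk₁, hℓ₁, G₁, hG₁, hlt₁⟩ := MICr.exists_rangeGrid_approx hμ hG₀
    (show 0 < ε / 3 by linarith)
  have hprob := ENNReal.tendsto_ofReal (MICr.tendsto_pow_mul_exp_neg_rpow
    (show β < 1 / 2 by linarith))
  rw [ENNReal.ofReal_zero] at hprob
  refine tendsto_of_tendsto_of_tendsto_of_le_of_le' tendsto_const_nhds hprob
    (Eventually.of_forall fun _ => zero_le) ?_
  filter_upwards [eventually_ge_atTop 1, herr.eventually (gt_mem_nhds (show 0 < ε / 3 by linarith)),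
    hBtop.eventually_ge_atTop 4, hBtop.eventually_ge_atTop ((k₁ * ℓ₁ : ℕ) : ℝ),
    MICr.eventually_le_natCast_of_isBigO (by linarith) hBO] with n hn hsmall hB4 hB₁ hBn
  refine (measure_mono ?_).trans (MICr.measure_exists_rangeGrid_deviation_le (hlaw n) (hindep n) L
    hn (δ := (n : ℝ) ^ (-β)) (by positivity) hγ0 hγ1)
  intro ω hω
  by_contra hgood
  simp only [Set.mem_ofPred_eq, not_exists, not_and, not_lt] at hω hgood
  have hn1 : (1 : ℝ) ≤ n := by exact_mod_cast hn
  have hdev : ∀ k ℓ : ℕ, 2 ≤ k → 2 ≤ ℓ → ((k * ℓ : ℕ) : ℝ) ≤ B n →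
      ∀ G ∈ MICr.rangeGrids L k ℓ,
      |MICr.normMutualInfo (MICr.sampleMatrix (fun i => D n i ω) G) -
        MICr.normMutualInfo (MICr.distMatrix μ G)| < ε / 3 := by
    intro k ℓ hk hℓ hkℓ G hG
    have hle : k * ℓ ≤ n := by exact_mod_cast hkℓ.trans hBn
    refine (hgood k ℓ hk hℓ (by nlinarith) (by nlinarith) G hG).trans_lt (lt_of_le_of_lt ?_ hsmall)
    -- Since `β < 1`, the bracketing error `1 / n` is absorbed, and `2 (δ + 1 / n) ≤ 4 n ^ (-β)`.
    have h1 : (1 : ℝ) / n ≤ (n : ℝ) ^ (-β) := by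
      rw [one_div, ← Real.rpow_neg_one]
      exact Real.rpow_le_rpow_of_exponent_le hn1 (by linarith)
    have h2 : (2 * ((n : ℝ) ^ (-β) + 1 / n)) ^ (1 - γ) ≤ (4 * (n : ℝ) ^ (-β)) ^ (1 - γ) :=
      Real.rpow_le_rpow (by positivity) (by linarith) (by linarith)
    push_cast at hkℓ
    calc _ = (k * ℓ : ℝ) * (2 * ((n : ℝ) ^ (-β) + 1 / n)) ^ (1 - γ) * (3 / γ / Real.log 2) := by
          ring
      _ ≤ B n * (4 * (n : ℝ) ^ (-β)) ^ (1 - γ) * (3 / γ / Real.log 2) := by gcongr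
  have hupper : MICr.micrUnconstrained (fun i => D n i ω) L (B n) ≤ MICr.micStar μ + ε / 3 := by
    refine MICr.micrUnconstrained_le _ hB4 fun k ℓ hk hℓ hkℓ G hG => ?_
    have h1 := (abs_lt.1 (hdev k ℓ hk hℓ hkℓ G hG)).2
    have h2 := MICr.normMutualInfo_le_micStar hμ hk hℓ hG
    linarith
  have hlower := MICr.normMutualInfo_sampleMatrix_le_micrUnconstrained (fun i => D n i ω) hk₁ hℓ₁
    hB₁ hG₁
  have hdev₁ := (abs_lt.1 (hdev k₁ ℓ₁ hk₁ hℓ₁ hB₁ G₁ hG₁)).1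
  refine hω.not_gt (abs_lt.2 ⟨?_, ?_⟩) <;> linarith
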